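/- All groups are finite. A group $G$ is *exponent-critical* if $\exp(G)$ is not the least common multiple of the exponents of the proper non-abelian subgroups of $G$ (the empty least common multiple being $1$). For a prime $p$, a *$p$-witness* for $G$ is a proper non-abelian subgroup $H$ of $G$ such that $\exp(G)$ and $\exp(H)$ have the same $p$-part. A group is *minimal non-abelian* if it is non-abelian and all its proper subgroups are abelian. A group $B$ acting by automorphisms on a group $V$ acts *irreducibly* if $V\neq 1$ and the only $B$-invariant subgroups of $V$ are $1$ and $V$. A $q$-group $Q$ is *special* if either $Q$ is elementary abelian, or $Q$ has nilpotency class $2$ with $Q'=Z(Q)=\Phi(Q)$ and $Q'$ elementary abelian. All actions below are by conjugation. **Theorem.** Let $p\neq q$ be primes and let $G$ be a finite group such that the primes dividing $|G|$ are exactly $p$ and $q$. (a) If $G$ is non-abelian and exponent-critical, then $G$ has no $p$-witness or $G$ has no $q$-witness. (b) If $G$ is non-abelian and exponent-critical and has no $p$-witness, then $G$ belongs to one of the following four families. (i) $G$ is the direct product of a cyclic Sylow $p$-subgroup of $G$ and its complement, which is minimal non-abelian. (ii) $G=P\rtimes Q$ with $P$ a normal abelian Sylow $p$-subgroup and $Q$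 a cyclic Sylow $q$-subgroup of $G$; $P$ is a direct product of cyclic groups of order $p^m$ for some integer $m\geq 1$; $|G:\mathbf{C}_G(P)|=q$; and $Q$ acts non-trivially and irreducibly on $P/P^p$, where $P^p$ is the subgroup generated by the $p$-th powers of elements of $P$. (iii) $G=P\rtimes Q$ with $P$ a normal abelian Sylow $p$-subgroup and $Q$ a cyclic Sylow $q$-subgroup of $G$; $P=C\times A$ with $C$ cyclic of order $p^m$ for some $m>1$ and $A$ elementary abelian; $Q$ normalizes $C$ and $A$, acts trivially on $C$, and acts non-trivially and irreducibly on $A$; and $|G:\mathbf{C}_G(P)|=q$. (iv) $G=Q\rtimes P$ with $Q$ a normal Sylow $q$-subgroup and $P$ a non-normal cyclic Sylow $p$-subgroup of $G$; $Q$ is special; and $P$ acts irreducibly on $Q/Q'$ and trivially on $Q'$. (c) Conversely, if $G$ belongs to one of the families (i)--(iv), then $G$ is exponent-critical. -/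

import Mathlib

namespace ExpCrit

/-- A finite group is exponent-critical if its exponent is not the least common multiple of the
exponents of its proper non-abelian subgroups (the empty least common multiple being `1`). -/
noncomputable def IsExponentCritical (G : Type*) [Group G] [Finite G] : Prop :=
  Monoid.exponent G ≠
    (Set.toFinite {H : Subgroup G | H ≠ ⊤ ∧ ¬ IsMulCommutative H}).toFinset.lcm
      (fun H => Monoid.exponent H)

/-- `H` is a `p`-witness for `G`: it is non-abelian, proper, and the `p`-parts of the exponents of
`G` and `H` are equal. -/
def IsWitness {G : Type*} [Group G] (p : ℕ) (H : Subgroup G) : Prop :=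
  ¬ IsMulCommutative H ∧ H ≠ ⊤ ∧
    ordProj[p] (Monoid.exponent G) = ordProj[p] (Monoid.exponent H)

/-- `G` is non-abelian and all its proper subgroups are abelian. -/
def IsMinimalNonabelian (G : Type*) [Group G] : Prop :=
  ¬ IsMulCommutative G ∧ ∀ H : Subgroup G, H ≠ ⊤ → IsMulCommutative H

/-- Elementary abelian `p`-groups (the trivial group included). -/
def IsElementaryAbelian (p : ℕ) (G : Type*) [Group G] : Prop :=
  IsMulCommutative G ∧ ∀ x : G, x ^ p = 1

/-- Special `q`-groups: either elementary abelian, or of nilpotency class `2` with derived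
subgroup, centre and Frattini subgroup all equal and elementary abelian. -/
def IsSpecial (q : ℕ) (Q : Type*) [Group Q] : Prop :=
  IsPGroup q Q ∧
    (IsElementaryAbelian q Q ∨
      (Group.nilpotencyClass Q = 2 ∧ commutator Q = Subgroup.center Q ∧
        Subgroup.center Q = frattini Q ∧ IsElementaryAbelian q (commutator Q)))

/-- The subgroup `V ^ n` generated by the `n`-th powers of elements of `V`. -/
def powers (V : Type*) [Group V] (n : ℕ) : Subgroup V :=
  Subgroup.closure (Set.range fun x : V => x ^ n)

instance powers_characteristic (V : Type*) [Group V] (n : ℕ) : (powers V n).Characteristic := by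
  refine Subgroup.characteristic_iff_map_le.mpr fun φ => ?_
  rw [powers, MonoidHom.map_closure, Subgroup.closure_le]
  rintro _ ⟨_, ⟨x, rfl⟩, rfl⟩
  exact Subgroup.subset_closure ⟨φ x, by simp⟩

/-- The action by conjugation of a subgroup `B` on a subgroup `A` that it normalizes. -/
def conjAction {G : Type*} [Group G] {A B : Subgroup G}
    (h : B ≤ Subgroup.normalizer (A : Set G)) : B →* MulAut A :=
  A.normalizerMonoidHom.comp (Subgroup.inclusion h)

/-- The action induced on the quotient by a characteristic subgroup. -/
def quotientAction {B V : Type*} [Group B] [Group V] (φ : B →* MulAut V)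
    (N : Subgroup V) [N.Characteristic] : B →* MulAut (V ⧸ N) where
  toFun b := QuotientGroup.congr N N (φ b)
    (Subgroup.characteristic_iff_map_eq.mp inferInstance (φ b))
  map_one' := by
    ext x
    induction x using QuotientGroup.induction_on with
    | H x => simp
  map_mul' a b := by
    ext x
    induction x using QuotientGroup.induction_on with
    | H x =>
      simp only [map_mul, MulAut.mul_apply, QuotientGroup.congr_mk]
      rfl

/-- `B` acts irreducibly on `V`: `V` is non-trivial, and its only `B`-invariant subgroups are the
trivial subgroup and `V` itself. -/
def ActsIrreducibly {B V : Type*} [Group B] [Group V] (φ : B →* MulAut V) : Prop :=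
  Nontrivial V ∧ ∀ W : Subgroup V, (∀ b : B, ∀ w ∈ W, φ b w ∈ W) → W = ⊥ ∨ W = ⊤

/-- `G` is the direct product of a cyclic Sylow `p`-subgroup and a complement that is minimal
non-abelian. -/
def FamilyI (p : ℕ) (G : Type*) [Group G] : Prop :=
  ∃ (P : Sylow p G) (K : Subgroup G),
    (P : Subgroup G).Normal ∧ K.Normal ∧ (P : Subgroup G).IsComplement' K ∧
    IsCyclic P ∧ IsMinimalNonabelian K

/-- `G = P ⋊ Q` with `P` a normal homocyclic Sylow `p`-subgroup of exponent `p ^ m`, `m > 0`, and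
`Q` a cyclic Sylow `q`-subgroup acting non-trivially and irreducibly on `P / P ^ p`, where
`|G : C_G(P)| = q`. -/
def FamilyII (p q : ℕ) (G : Type*) [Group G] : Prop :=
  ∃ (P : Sylow p G) (Q : Sylow q G) (m n : ℕ)
    (hQP : (Q : Subgroup G) ≤ Subgroup.normalizer ((P : Subgroup G) : Set G)),
    (P : Subgroup G).Normal ∧ (P : Subgroup G).IsComplement' (Q : Subgroup G) ∧
    IsMulCommutative P ∧ IsCyclic Q ∧
    0 < m ∧ Nonempty (P ≃* (Fin n → Multiplicative (ZMod (p ^ m)))) ∧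
    (Subgroup.centralizer ((P : Subgroup G) : Set G)).index = q ∧
    quotientAction (conjAction hQP) (powers (P : Subgroup G) p) ≠ 1 ∧
    ActsIrreducibly (quotientAction (conjAction hQP) (powers (P : Subgroup G) p))

/-- `G = P ⋊ Q` with `P = C × A` a normal abelian Sylow `p`-subgroup, `C` cyclic of order `p ^ m`,
`m > 1`, and `A` elementary abelian, and with `Q` a cyclic Sylow `q`-subgroup normalizing `C` and
`A`, acting trivially on `C` and non-trivially and irreducibly on `A`, where
`|G : C_G(P)| = q`. -/
def FamilyIII (p q : ℕ) (G : Type*) [Group G] : Prop :=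
  ∃ (P : Sylow p G) (Q : Sylow q G) (m : ℕ) (C A : Subgroup G)
    (hQC : (Q : Subgroup G) ≤ Subgroup.normalizer (C : Set G))
    (hQA : (Q : Subgroup G) ≤ Subgroup.normalizer (A : Set G)),
    (P : Subgroup G).Normal ∧ (P : Subgroup G).IsComplement' (Q : Subgroup G) ∧
    IsMulCommutative P ∧ IsCyclic Q ∧
    C ⊓ A = ⊥ ∧ C ⊔ A = (P : Subgroup G) ∧
    1 < m ∧ IsCyclic C ∧ Nat.card C = p ^ m ∧ IsElementaryAbelian p A ∧
    conjAction hQC = 1 ∧ conjAction hQA ≠ 1 ∧ ActsIrreducibly (conjAction hQA) ∧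
    (Subgroup.centralizer ((P : Subgroup G) : Set G)).index = q

/-- `G = Q ⋊ P` with `Q` a normal special Sylow `q`-subgroup and `P` a non-normal cyclic Sylow
`p`-subgroup acting irreducibly on `Q / Q'` and trivially on `Q'`. -/
def FamilyIV (p q : ℕ) (G : Type*) [Group G] : Prop :=
  ∃ (P : Sylow p G) (Q : Sylow q G)
    (hPQ : (P : Subgroup G) ≤ Subgroup.normalizer ((Q : Subgroup G) : Set G)),
    (Q : Subgroup G).Normal ∧ ¬ (P : Subgroup G).Normal ∧
    (Q : Subgroup G).IsComplement' (P : Subgroup G) ∧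
    IsCyclic P ∧ IsSpecial q Q ∧
    ActsIrreducibly (quotientAction (conjAction hPQ) (commutator (Q : Subgroup G))) ∧
    ∀ (x : (P : Subgroup G)), ∀ z ∈ commutator (Q : Subgroup G), conjAction hPQ x z = z

end ExpCrit

/-! ### Prime parts of the exponent, and witnesses. -/

namespace ExpCrit

/-! Let p^e be the p-part of exp(G). The lcm of the exponents of the proper non-abelian subgroups
divides exp(G), and it contains the factor p^e exactly when a p-witness exists. So witnesses for
both primes rule out criticality, while the lack of a p-witness forces it. As a p-witness contains
an element of order p^e, having none means that every proper subgroup containing such an element is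
abelian (`AbelianAbove`). Everything else is a study of this condition.

For the classification, a Sylow p-subgroup P containing an element of order p^e is proper, hence
abelian. If P is not normal, its normalizer is abelian, and Burnside's transfer theorem gives a
normal Sylow q-subgroup Q. If both Sylow subgroups are normal, the group is a direct product and
`FamilyI` follows quickly. Otherwise the non-normal Sylow subgroup is cyclic, generated by some y,
and conjugation by y is a coprime automorphism φ of the normal one. Its invariant subgroups are
severely restricted: joining one to the cyclic factor gives either G or, if an element of order p^e
is present, an abelian group, on which φ acts trivially. For normal P, `abelian_action_dichotomy`
uses P = C_P(φ) × [P,φ] and Maschke's theorem to get `FamilyII` or `FamilyIII`. For normal Q, every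
proper invariant subgroup is abelian and fixed pointwise, and `isSpecial_of_forall_fixed` gives
`FamilyIV`.

For the converse, a p-witness H contains an element of order p^e. In each family irreducibility then
makes H either abelian or all of G. -/

theorem exponent_subgroup_dvd {G : Type*} [Group G] (H : Subgroup G) :
    Monoid.exponent H ∣ Monoid.exponent G :=
  Monoid.exponent_dvd_of_monoidHom H.subtype H.subtype_injective

theorem pow_dvd_lcm_iff {p k a b : ℕ} (hp : p.Prime) (ha : a ≠ 0) (hb : b ≠ 0) :
    p ^ k ∣ Nat.lcm a b ↔ p ^ k ∣ a ∨ p ^ k ∣ b := by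
  rw [hp.pow_dvd_iff_le_factorization (Nat.lcm_ne_zero ha hb), Nat.factorization_lcm ha hb,
    hp.pow_dvd_iff_le_factorization ha, hp.pow_dvd_iff_le_factorization hb, Finsupp.sup_apply,
    le_sup_iff]

/-- The p-adic valuation of an lcm is the maximum of the valuations. The condition `k ≠ 0` excludes
the empty family, whose lcm 1 is divisible by p^0. -/
theorem exists_pow_dvd_of_pow_dvd_lcm {ι : Type*} {p k : ℕ} (hp : p.Prime) (hk : k ≠ 0)
    (s : Finset ι) (f : ι → ℕ) (hf : ∀ i ∈ s, f i ≠ 0) (h : p ^ k ∣ s.lcm f) :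
    ∃ i ∈ s, p ^ k ∣ f i := by
  classical
  induction s using Finset.induction_on with
  | empty =>
    rw [Finset.lcm_empty, Nat.dvd_one, Nat.pow_eq_one] at h
    exact absurd h (by simp [hp.ne_one, hk])
  | insert a s _ ih =>
    rw [Finset.lcm_insert, lcm_eq_nat_lcm,
      pow_dvd_lcm_iff hp (hf a (Finset.mem_insert_self a s))] at h
    · rcases h with h | h
      · exact ⟨a, Finset.mem_insert_self a s, h⟩
      · obtain ⟨i, hi, hd⟩ := ih (fun i hi => hf i (Finset.mem_insert_of_mem hi)) h
        exact ⟨i, Finset.mem_insert_of_mem hi, hd⟩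
    · rw [Ne, Finset.lcm_eq_zero_iff]
      rintro ⟨i, hi, h0⟩
      exact hf i (Finset.mem_insert_of_mem hi) h0

section

variable {G : Type*} [Group G] [Finite G] {p : ℕ}

theorem IsWitness.pow_dvd {k : ℕ} {H : Subgroup G} (hp : p.Prime) (hH : IsWitness p H)
    (hk : p ^ k ∣ Monoid.exponent G) : p ^ k ∣ Monoid.exponent H := by
  rw [hp.pow_dvd_iff_dvd_ordProj Monoid.exponent_ne_zero_of_finite] at hk
  exact (hH.2.2 ▸ hk).trans (Nat.ordProj_dvd _ _)

/-- Each prime power dividing exp(G) belongs to p or q, hence divides the exponent of the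
corresponding witness; with both witnesses the lcm would be exp(G). -/
theorem IsExponentCritical.not_exists_isWitness_or {q : ℕ} (hG : (Nat.card G).primeFactors = {p, q})
    (hc : IsExponentCritical G) :
    (¬ ∃ H : Subgroup G, IsWitness p H) ∨ ¬ ∃ H : Subgroup G, IsWitness q H := by
  by_contra! hcon
  obtain ⟨⟨H, hH⟩, K, hK⟩ := hcon
  refine hc (Nat.dvd_antisymm ?_ (Finset.lcm_dvd fun L _ => exponent_subgroup_dvd L))
  rw [Nat.dvd_iff_prime_pow_dvd_dvd]
  intro r k hr hrk
  rcases Nat.eq_zero_or_pos k with rfl | hk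
  · simp
  have hmem : r ∈ (Nat.card G).primeFactors :=
    Nat.mem_primeFactors.mpr ⟨hr, (dvd_pow_self r hk.ne').trans
      (hrk.trans Group.exponent_dvd_nat_card), Nat.card_pos.ne'⟩
  rw [hG, Finset.mem_insert, Finset.mem_singleton] at hmem
  rcases hmem with rfl | rfl
  · exact (hH.pow_dvd hr hrk).trans
      (Finset.dvd_lcm (f := fun L : Subgroup G => Monoid.exponent L) (by simp [hH.1, hH.2.1]))
  · exact (hK.pow_dvd hr hrk).trans
      (Finset.dvd_lcm (f := fun L : Subgroup G => Monoid.exponent L) (by simp [hK.1, hK.2.1]))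

theorem factorization_exponent_pos (hp : p.Prime) (hpG : p ∣ Nat.card G) :
    0 < (Monoid.exponent G).factorization p := by
  have := Fact.mk hp
  obtain ⟨x, hx⟩ := exists_prime_orderOf_dvd_card' p hpG
  exact hp.factorization_pos_of_dvd Monoid.exponent_ne_zero_of_finite
    (hx ▸ Monoid.order_dvd_exponent x)

theorem isWitness_of_pow_dvd (hp : p.Prime) {H : Subgroup G} (hH : ¬ IsMulCommutative H)
    (hT : H ≠ ⊤) (hd : p ^ (Monoid.exponent G).factorization p ∣ Monoid.exponent H) :
    IsWitness p H := by
  refine ⟨hH, hT, ?_⟩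
  congr 1
  refine le_antisymm ?_ ?_
  · exact (hp.pow_dvd_iff_le_factorization Monoid.exponent_ne_zero_of_finite).mp hd
  · exact (Nat.factorization_le_iff_dvd Monoid.exponent_ne_zero_of_finite
      Monoid.exponent_ne_zero_of_finite).mpr (exponent_subgroup_dvd H) p

/-- If the lcm were exp(G), some single entry would carry the full p-part and be a witness.
Divisibility of |G| by p makes that p-part non-trivial, which excludes an empty lcm. -/
theorem isExponentCritical_of_forall_not_isWitness (hp : p.Prime) (hpG : p ∣ Nat.card G)
    (h : ∀ H : Subgroup G, ¬ IsWitness p H) : IsExponentCritical G := by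
  intro heq
  obtain ⟨H, hH, hd⟩ := exists_pow_dvd_of_pow_dvd_lcm hp (factorization_exponent_pos hp hpG).ne' _ _
    (fun _ _ => Monoid.exponent_ne_zero_of_finite) 
    ((Nat.ordProj_dvd (Monoid.exponent G) p).trans heq.dvd)
  rw [Set.Finite.mem_toFinset] at hH
  exact h H (isWitness_of_pow_dvd hp hH.2 hH.1 hd)

theorem orderOf_le_of_factorization (hp : p.Prime) {g : G} {k : ℕ} (hg : orderOf g = p ^ k) :
    k ≤ (Monoid.exponent G).factorization p :=
  (hp.pow_dvd_iff_le_factorization Monoid.exponent_ne_zero_of_finite).mp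
    (hg ▸ Monoid.order_dvd_exponent g)

omit [Finite G] in
theorem IsWitness.exists_orderOf_eq (hp : p.Prime) {H : Subgroup G} (hH : IsWitness p H) :
    ∃ z ∈ H, orderOf z = p ^ (Monoid.exponent G).factorization p := by
  obtain ⟨z, hz⟩ := hp.exists_orderOf_eq_pow_factorization_exponent H
  exact ⟨z, z.2, by rw [Subgroup.orderOf_coe, hz, hH.2.2]⟩

/-- An element of order p^e forces full p-part on the exponent of any subgroup containing it, so
such a proper subgroup would be a witness if it were non-abelian. -/
theorem commute_of_forall_not_isWitness (hp : p.Prime) (h : ¬ ∃ H : Subgroup G, IsWitness p H)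
    (H : Subgroup G) (x : G) (hxH : x ∈ H)
    (hx : orderOf x = p ^ (Monoid.exponent G).factorization p) (hT : H ≠ ⊤) :
    ∀ a ∈ H, ∀ b ∈ H, a * b = b * a := by
  by_contra hcon
  refine h ⟨H, isWitness_of_pow_dvd hp (fun hc => hcon (isMulCommutative_iff_of_setLike.mp hc))
    hT ?_⟩
  rw [← hx, ← Subgroup.orderOf_mk x hxH]
  exact Monoid.order_dvd_exponent _

end
end ExpCrit

/-! ### Coprime automorphisms, homocyclic groups and the Frattini subgroup. -/

namespace ExpCrit

section Coprime

theorem iterate_eq_mul_pow {V : Type*} [Group V] (φ : V →* V) {u v : V} (h : φ u = u * v)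
    (hv : φ v = v) (n : ℕ) : φ^[n] u = u * v ^ n := by
  induction n with
  | zero => simp
  | succ n ih => rw [Function.iterate_succ_apply', ih, map_mul, map_pow, h, hv, mul_assoc, pow_succ']

/-- If an automorphism of order prime to `|V|` fixes the displacement `v` of `u`, then it
fixes `u`. -/
theorem eq_one_of_map_eq_mul {V : Type*} [Group V] (φ : V →* V) {n : ℕ} (hφ : ∀ v, φ^[n] v = v)
    (hcop : (Nat.card V).Coprime n) {u v : V} (h : φ u = u * v) (hv : φ v = v) : v = 1 := by
  have h1 := iterate_eq_mul_pow φ h hv n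
  rw [hφ, left_eq_mul] at h1
  exact orderOf_eq_one_iff.mp (Nat.eq_one_of_dvd_coprimes hcop
    (orderOf_dvd_natCard _) (orderOf_dvd_of_pow_eq_one h1))

variable {V : Type*} [CommGroup V]

theorem map_div_eq_one (φ : V →* V) {n : ℕ} (hφ : ∀ v, φ^[n] v = v)
    (hcop : (Nat.card V).Coprime n) {u : V} (hu : φ (φ u / u) = φ u / u) : φ u / u = 1 :=
  eq_one_of_map_eq_mul φ hφ hcop (mul_div_cancel u (φ u)).symm hu

/-- A coprime automorphism of an abelian group that moves some element, but fixes all elements of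
every proper invariant subgroup, acts irreducibly. -/
theorem eq_bot_or_eq_top_of_forall_fixed [Finite V] (φ : V →* V) {n : ℕ}
    (hφ : ∀ v, φ^[n] v = v) (hcop : (Nat.card V).Coprime n) (hne : ∃ v, φ v ≠ v)
    (hfix : ∀ W : Subgroup V, (∀ w ∈ W, φ w ∈ W) → W ≠ ⊤ → ∀ w ∈ W, φ w = w)
    (W : Subgroup V) (hW : ∀ w ∈ W, φ w ∈ W) : W = ⊥ ∨ W = ⊤ := by
  -- The displacement map, with kernel the fixed points. A proper image would be fixed pointwise,
  -- and coprimality would make it trivial; so δ is onto, hence injective, and a pointwise fixed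
  -- subgroup is trivial.
  let δ : V →* V := φ / MonoidHom.id V
  have hδ : ∀ v, φ v = v * δ v := fun v => by simp [δ]
  have hrange : δ.range = ⊤ := by
    by_contra hT
    obtain ⟨v, hv⟩ := hne
    have hfixv := hfix δ.range (by rintro _ ⟨u, rfl⟩; exact ⟨φ u, by simp [δ]⟩) hT (δ v) ⟨v, rfl⟩
    have h2 : δ v = 1 := map_div_eq_one φ hφ hcop hfixv
    exact hv (by rw [hδ, h2, mul_one])
  have hinj : Function.Injective δ :=
    Finite.injective_iff_surjective.mpr (MonoidHom.range_eq_top.mp hrange)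
  refine or_iff_not_imp_right.mpr fun hT => (Subgroup.eq_bot_iff_forall W).mpr fun w hw => ?_
  apply hinj
  rw [map_one]
  simpa [hfix W hW hT w hw] using hδ w

/-- φ is a root of X^n - 1, which is separable over the field of p elements because p does not
divide n; so φ is a semisimple endomorphism. -/
theorem exists_invariant_addSubgroup_isCompl {M : Type*} [AddCommGroup M] {p n : ℕ}
    [Fact p.Prime] [Module (ZMod p) M] (φ : M →+ M) (hn : ¬ p ∣ n) (hφ : ∀ v, φ^[n] v = v)
    (U : AddSubgroup M) (hU : ∀ u ∈ U, φ u ∈ U) :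
    ∃ W : AddSubgroup M, (∀ w ∈ W, φ w ∈ W) ∧ IsCompl U W := by
  let f : Module.End (ZMod p) M := φ.toZModLinearMap p
  let E : AddSubgroup M ≃o Submodule (ZMod p) M := AddSubgroup.toZModSubmodule p
  have hsq : Squarefree (Polynomial.X ^ n - 1 : Polynomial (ZMod p)) :=
    (Polynomial.X_pow_sub_one_separable_iff.mpr
      (by rwa [Ne, ZMod.natCast_eq_zero_iff])).squarefree
  have hss : f.IsSemisimple := by
    refine Module.End.isSemisimple_of_squarefree_aeval_eq_zero hsq ?_
    ext v
    have hfn : (f ^ n) v = v := by rw [Module.End.pow_apply]; exact hφ v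
    simp [hfn]
  obtain ⟨W, hW, hc⟩ := Module.End.isSemisimple_iff.mp hss (E U) (fun u hu => hU u hu)
  refine ⟨E.symm W, fun w hw => hW hw, ?_⟩
  rw [E.isCompl_iff, E.apply_symm_apply]
  exact hc

/-- Maschke's theorem for a single automorphism of an elementary abelian group. -/
theorem exists_invariant_isCompl {p n : ℕ} [Fact p.Prime] (hV : ∀ v : V, v ^ p = 1)
    (φ : V →* V) (hn : ¬ p ∣ n) (hφ : ∀ v, φ^[n] v = v) (U : Subgroup V)
    (hU : ∀ u ∈ U, φ u ∈ U) :
    ∃ W : Subgroup V, (∀ w ∈ W, φ w ∈ W) ∧ IsCompl U W := by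
  have hm : ∀ v : Additive V, p • v = 0 := fun v => hV v.toMul
  obtain ⟨W, hW, hc⟩ := @exists_invariant_addSubgroup_isCompl (Additive V) _ p n _
    (AddCommGroup.zmodModule hm) (MonoidHom.toAdditive φ) hn hφ (Subgroup.toAddSubgroup U) hU
  refine ⟨Subgroup.toAddSubgroup.symm W, hW, ?_⟩
  rw [Subgroup.toAddSubgroup.isCompl_iff, OrderIso.apply_symm_apply]
  exact hc

end Coprime

/-- A finite abelian group of exponent dividing `p ^ e` in which the elements of order dividing
`p ^ (e - 1)` are `p`-th powers is homocyclic. -/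
theorem exists_mulEquiv_pi_zmod {V : Type*} [CommGroup V] [Finite V] {p e : ℕ} (hp : p.Prime)
    (hexp : ∀ v : V, v ^ p ^ e = 1) (hpow : ∀ v : V, v ^ p ^ (e - 1) = 1 → ∃ w, w ^ p = v) :
    ∃ n : ℕ, Nonempty (V ≃* (Fin n → Multiplicative (ZMod (p ^ e)))) := by
  classical
  obtain ⟨ι, _, n, hn, ⟨E⟩⟩ := CommGroup.equiv_prod_multiplicative_zmod_of_finite V
  have hne : ∀ i, n i = p ^ e := by
    intro i
    -- A generator of the i-th cyclic factor. If its order p^k had k < e, it would be a p-th power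
    -- by `hpow`; but a generator of a non-trivial cyclic p-group is not a p-th power in it.
    let g : (i : ι) → Multiplicative (ZMod (n i)) := Pi.mulSingle i (Multiplicative.ofAdd 1)
    have hg : ∀ k : ℕ, g ^ k = 1 ↔ n i ∣ k := by
      intro k
      rw [← Pi.mulSingle_pow, Pi.mulSingle_eq_one_iff, ← ofAdd_nsmul, ofAdd_eq_one, nsmul_one,
        ZMod.natCast_eq_zero_iff]
    have hgE : ∀ k : ℕ, (E.symm g) ^ k = 1 ↔ n i ∣ k := by
      intro k
      rw [← map_pow, EmbeddingLike.map_eq_one_iff, hg]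
    obtain ⟨k, hk, hnk⟩ := (Nat.dvd_prime_pow hp).mp ((hgE _).mp (hexp _))
    rcases hk.eq_or_lt with rfl | hlt
    · exact hnk
    exfalso
    have hk0 : k ≠ 0 := by
      rintro rfl
      have := hn i
      simp [hnk] at this
    obtain ⟨w, hw⟩ := hpow (E.symm g) ((hgE _).mpr (hnk ▸ pow_dvd_pow p (by omega)))
    have hc : (E w i) ^ p = Multiplicative.ofAdd 1 := by
      rw [← Pi.pow_apply, ← map_pow, hw, MulEquiv.apply_symm_apply]
      exact Pi.mulSingle_eq_same _ _
    have hcard : (E w i) ^ n i = 1 := by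
      have := pow_card_eq_one' (x := E w i)
      rwa [Nat.card_congr Multiplicative.toAdd, Nat.card_zmod] at this
    have h1 : (Multiplicative.ofAdd 1 : Multiplicative (ZMod (n i))) ^ p ^ (k - 1) = 1 := by
      rw [← hc, ← pow_mul, ← pow_succ', Nat.sub_add_cancel (Nat.pos_of_ne_zero hk0), ← hnk, hcard]
    rw [← ofAdd_nsmul, ofAdd_eq_one, nsmul_one, ZMod.natCast_eq_zero_iff, hnk,
      Nat.pow_dvd_pow_iff_le_right hp.one_lt] at h1
    omega
  obtain rfl : n = fun _ => p ^ e := funext hne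
  exact ⟨Fintype.card ι, ⟨E.trans
    (MulEquiv.arrowCongr (Fintype.equivFin ι) (MulEquiv.refl _))⟩⟩

/-- Maximal subgroups of a nilpotent group are normal, and their quotients are simple and solvable,
hence abelian. -/
theorem commutator_le_frattini (Q : Type*) [Group Q] [Finite Q] [Group.IsNilpotent Q] :
    commutator Q ≤ frattini Q := by
  refine le_iInf₂ fun M hM => ?_
  have hM : IsCoatom M := hM
  have : M.Normal := Subgroup.NormalizerCondition.normal_of_coatom M
    Group.normalizerCondition_of_isNilpotent hM
  have : IsSimpleGroup (Q ⧸ M) := by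
    have : Nontrivial (Q ⧸ M) := QuotientGroup.nontrivial_iff.mpr hM.1
    refine ⟨fun N _ => ?_⟩
    have hle : M ≤ N.comap (QuotientGroup.mk' M) := by
      simpa using (QuotientGroup.mk' M).ker_le_comap N
    rw [← Subgroup.map_comap_eq_self_of_surjective (QuotientGroup.mk'_surjective M) N]
    rcases hM.le_iff.mp hle with h | h
    · right
      rw [h, Subgroup.map_top_of_surjective _ (QuotientGroup.mk'_surjective M)]
    · left
      rw [h, QuotientGroup.map_mk'_self]
  rw [← Subgroup.Normal.quotient_commutative_iff_commutator_le, isMulCommutative_iff]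
  exact IsSimpleGroup.comm_iff_isSolvable.mpr inferInstance

/-! ### Irreducibility restated through invariant subgroups. -/

section Actions

theorem actsIrreducibly_quotientAction_iff {B V : Type*} [Group B] [Group V] (φ : B →* MulAut V)
    (N : Subgroup V) [N.Characteristic] :
    ActsIrreducibly (quotientAction φ N) ↔ N ≠ ⊤ ∧
      ∀ U : Subgroup V, N ≤ U → (∀ b : B, ∀ u ∈ U, φ b u ∈ U) → U = N ∨ U = ⊤ := by
  have hsurj := QuotientGroup.mk'_surjective N
  have hact : ∀ b v, quotientAction φ N b (QuotientGroup.mk' N v) = QuotientGroup.mk' N (φ b v) :=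
    fun _ _ => rfl
  rw [ActsIrreducibly, QuotientGroup.nontrivial_iff]
  refine and_congr_right fun _ => ⟨fun h U hNU hU => ?_, fun h W hW => ?_⟩
  · have hcomap : (U.map (QuotientGroup.mk' N)).comap (QuotientGroup.mk' N) = U := by
      rw [Subgroup.comap_map_eq, QuotientGroup.ker_mk', sup_eq_left.mpr hNU]
    rcases h (U.map (QuotientGroup.mk' N)) (by
      rintro b _ ⟨u, hu, rfl⟩
      exact ⟨φ b u, hU b u hu, rfl⟩) with h | h
    · left
      rw [← hcomap, h, MonoidHom.comap_bot, QuotientGroup.ker_mk']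
    · right
      rw [← hcomap, h, Subgroup.comap_top]
  · rw [← Subgroup.map_comap_eq_self_of_surjective hsurj W]
    rcases h (W.comap (QuotientGroup.mk' N))
      (by simpa using (QuotientGroup.mk' N).ker_le_comap W)
      (fun b u hu => by
        rw [Subgroup.mem_comap, ← hact]
        exact hW b _ hu) with h | h
    · left
      rw [h, QuotientGroup.map_mk'_self]
    · right
      rw [h, Subgroup.map_top_of_surjective _ hsurj]

theorem coe_conjAction_apply {G : Type*} [Group G] {A B : Subgroup G}
    (h : B ≤ Subgroup.normalizer (A : Set G)) (b : B) (a : A) :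
    (conjAction h b a : G) = b * a * (b : G)⁻¹ := rfl

theorem actsIrreducibly_conjAction_iff {G : Type*} [Group G] {A B : Subgroup G}
    (h : B ≤ Subgroup.normalizer (A : Set G)) :
    ActsIrreducibly (conjAction h) ↔ A ≠ ⊥ ∧
      ∀ W ≤ A, (∀ b ∈ B, ∀ w ∈ W, b * w * b⁻¹ ∈ W) → W = ⊥ ∨ W = A := by
  rw [ActsIrreducibly, Subgroup.nontrivial_iff_ne_bot]
  refine and_congr_right fun _ => ⟨fun hirr W hWA hW => ?_, fun hirr W hW => ?_⟩
  · rw [← Subgroup.map_subgroupOf_eq_of_le hWA]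
    rcases hirr (W.subgroupOf A) fun b w hw => hW b b.2 w hw with h | h
    · left
      rw [h, Subgroup.map_bot]
    · right
      rw [h, ← MonoidHom.range_eq_map, Subgroup.range_subtype]
  · rcases hirr (W.map A.subtype) (Subgroup.map_subtype_le W) (by
      rintro b hb _ ⟨w, hw, rfl⟩
      exact ⟨conjAction h ⟨b, hb⟩ w, hW _ w hw, rfl⟩) with h | h
    · left
      exact (Subgroup.map_eq_bot_iff_of_injective W A.subtype_injective).mp h
    · right
      refine Subgroup.map_injective A.subtype_injective ?_
      rw [h, ← MonoidHom.range_eq_map, Subgroup.range_subtype]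

end Actions
end ExpCrit

/-! ### Coprime automorphisms of abelian p-groups. -/

namespace ExpCrit

section AbelianAction

variable {V : Type*} [CommGroup V]

theorem mem_powers_iff {n : ℕ} {v : V} : v ∈ powers V n ↔ ∃ w, w ^ n = v := by
  have h : powers V n = (powMonoidHom n : V →* V).range := by
    rw [powers, ← Subgroup.closure_eq (powMonoidHom n : V →* V).range]
    rfl
  rw [h]
  exact Iff.rfl

variable [Finite V] (φ : V →* V) {n : ℕ}

/-- This is V = C_V(φ) · [V,φ]. The kernel and image of the displacement map meet trivially by
coprimality, and their orders multiply to |V|. -/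
theorem exists_fixed_mul_map_div (hφ : ∀ v, φ^[n] v = v) (hcop : (Nat.card V).Coprime n) (v : V) :
    ∃ c u : V, φ c = c ∧ c * (φ u / u) = v := by
  let δ : V →* V := φ / MonoidHom.id V
  have hdisj : Disjoint δ.ker δ.range := by
    rw [Subgroup.disjoint_def]
    rintro _ hc ⟨u, rfl⟩
    exact map_div_eq_one φ hφ hcop (div_eq_one.mp hc)
  have hcard : Nat.card δ.ker * Nat.card δ.range = Nat.card V := by
    rw [← Subgroup.index_ker, Subgroup.card_mul_index]
  have htop := (Subgroup.isComplement'_of_card_mul_and_disjoint hcard hdisj).sup_eq_top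
  obtain ⟨c, hc, _, ⟨u, rfl⟩, h⟩ := Subgroup.mem_sup.mp (htop ▸ Subgroup.mem_top v)
  exact ⟨c, u, div_eq_one.mp hc, h⟩

omit [Finite V] in
theorem exists_mem_pow_pow_eq {p : ℕ} {A : Subgroup V} (h : ∀ a ∈ A, ∃ b ∈ A, b ^ p = a) (k : ℕ) :
    ∀ a ∈ A, ∃ b ∈ A, b ^ p ^ k = a := by
  induction k with
  | zero => exact fun a ha => ⟨a, ha, by simp⟩
  | succ k ih =>
    intro a ha
    obtain ⟨b, hb, rfl⟩ := ih a ha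
    obtain ⟨c, hc, rfl⟩ := h b hb
    exact ⟨c, hc, by rw [← pow_mul, ← pow_succ']⟩

/-- The structure of a coprime automorphism of an abelian `p`-group that fixes every element of each
proper invariant subgroup of full exponent. -/
theorem abelian_action_dichotomy {p e : ℕ} [Fact p.Prime] (he : 0 < e)
    (hexp : ∀ v : V, v ^ p ^ e = 1) (hx : ∃ x : V, orderOf x = p ^ e) (hφ : ∀ v, φ^[n] v = v)
    (hn : p.Coprime n) (hne : ∃ v, φ v ≠ v)
    (hdich : ∀ U : Subgroup V, (∀ u ∈ U, φ u ∈ U) → (∃ u ∈ U, orderOf u = p ^ e) →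
      U = ⊤ ∨ ∀ u ∈ U, φ u = u) :
    (∃ (c : V) (A : Subgroup V), 1 < e ∧ orderOf c = p ^ e ∧ φ c = c ∧
      IsCompl (Subgroup.zpowers c) A ∧ (∀ a ∈ A, a ^ p = 1) ∧ (∀ a ∈ A, φ a ∈ A) ∧
      (∃ a ∈ A, φ a ≠ a) ∧ ∀ W ≤ A, (∀ w ∈ W, φ w ∈ W) → W = ⊥ ∨ W = A) ∨
    ((∀ v : V, v ^ p ^ (e - 1) = 1 → ∃ w, w ^ p = v) ∧ (∃ v, φ v / v ∉ powers V p) ∧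
      ∀ U : Subgroup V, powers V p ≤ U → (∀ u ∈ U, φ u ∈ U) → U = powers V p ∨ U = ⊤) := by
  have hp : p.Prime := Fact.out
  have hVp : IsPGroup p V := fun v => ⟨e, hexp v⟩
  have hcop : (Nat.card V).Coprime n := by
    obtain ⟨k, hk⟩ := hVp.exists_card_eq
    rw [hk]
    exact hn.pow_left k
  have horder : ∀ v : V, v ^ p ^ (e - 1) ≠ 1 → orderOf v = p ^ e := by
    intro v hv
    have := orderOf_eq_prime_pow hv (by rw [Nat.sub_add_cancel he]; exact hexp v)
    rwa [Nat.sub_add_cancel he] at this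
  have horder' : ∀ v : V, orderOf v = p ^ e → v ^ p ^ (e - 1) ≠ 1 := by
    intro v hv h1
    have := orderOf_dvd_of_pow_eq_one h1
    rw [hv, Nat.pow_dvd_pow_iff_le_right hp.one_lt] at this
    omega
  let A : Subgroup V := (φ / MonoidHom.id V).range
  have hAmem : ∀ u, φ u / u ∈ A := fun u => ⟨u, rfl⟩
  have hAinv : ∀ a ∈ A, φ a ∈ A := by
    rintro _ ⟨u, rfl⟩
    exact ⟨φ u, by simp⟩
  have hAfix : ∀ a ∈ A, φ a = a → a = 1 := by
    rintro _ ⟨u, rfl⟩ h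
    exact map_div_eq_one φ hφ hcop h
  have hAne : ∃ a ∈ A, φ a ≠ a := by
    obtain ⟨v, hv⟩ := hne
    exact ⟨φ v / v, hAmem v, fun h => hv (div_eq_one.mp (hAfix _ (hAmem v) h))⟩
  obtain ⟨x, hx⟩ := hx
  obtain ⟨c, u, hc, hcu⟩ := exists_fixed_mul_map_div φ hφ hcop x
  -- In x = c · (φ u / u) at least one factor has order p^e. If c does not, the displacement does,
  -- which leads to the homocyclic case; if c does, it generates the cyclic direct factor.
  by_cases hc1 : c ^ p ^ (e - 1) = 1
  · right
    have hu : orderOf (φ u / u) = p ^ e := by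
      refine horder _ fun h => horder' x hx ?_
      rw [← hcu, mul_pow, hc1, h, one_mul]
    -- A = [V,φ] is invariant, has full exponent and is not fixed pointwise. Once A is everything, φ
    -- fixes only 1, so proper invariant subgroups have smaller exponent.
    have hAtop : A = ⊤ := by
      refine (hdich A hAinv ⟨_, hAmem u, hu⟩).resolve_right fun h => ?_
      obtain ⟨a, ha, hne⟩ := hAne
      exact hne (h a ha)
    have hsmall : ∀ U : Subgroup V, (∀ u ∈ U, φ u ∈ U) → U ≠ ⊤ → ∀ u ∈ U, u ^ p ^ (e - 1) = 1 := by
      intro U hU hT u huU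
      by_contra hcon
      have hfix := (hdich U hU ⟨u, huU, horder u hcon⟩).resolve_left hT u huU
      exact hcon (by rw [hAfix u (hAtop ▸ Subgroup.mem_top u) hfix, one_pow])
    have hNM : ∀ v ∈ powers V p, v ^ p ^ (e - 1) = 1 := by
      intro v hv
      obtain ⟨w, rfl⟩ := mem_powers_iff.mp hv
      rw [← pow_mul, ← pow_succ', Nat.sub_add_cancel he, hexp]
    have hNinv : ∀ v ∈ powers V p, φ v ∈ powers V p := by
      intro v hv
      obtain ⟨w, rfl⟩ := mem_powers_iff.mp hv
      exact mem_powers_iff.mpr ⟨φ w, by rw [map_pow]⟩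
    -- Let M be the kernel of the power map p^(e-1), and take an invariant complement W to the image
    -- of M in V/V^p. If the preimage of W were proper, it would lie in M, so W would lie in the
    -- image of M and V = M V^p = M, contradicting the order of x. So W is everything and M has
    -- trivial image.
    have hMN : ∀ v : V, v ^ p ^ (e - 1) = 1 → v ∈ powers V p := by
      let M : Subgroup V := (powMonoidHom (p ^ (e - 1)) : V →* V).ker
      let π := QuotientGroup.mk' (powers V p)
      let φ' : V ⧸ powers V p →* V ⧸ powers V p := QuotientGroup.map _ _ φ hNinv
      have hφ'π : ∀ v, φ' (π v) = π (φ v) := fun _ => rfl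
      have hπ : Function.Surjective π := QuotientGroup.mk'_surjective _
      have hiter : ∀ (k : ℕ) (v : V), φ'^[k] (π v) = π (φ^[k] v) := by
        intro k v
        induction k with
        | zero => rfl
        | succ k ih => rw [Function.iterate_succ_apply', ih, hφ'π, Function.iterate_succ_apply']
      obtain ⟨W, hW, hcompl⟩ := exists_invariant_isCompl (p := p) (n := n)
        (V := V ⧸ powers V p) (by
          intro v
          obtain ⟨v, rfl⟩ := hπ v
          rw [← map_pow]
          exact (QuotientGroup.eq_one_iff _).mpr (mem_powers_iff.mpr ⟨v, rfl⟩))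
        φ' ((Nat.Prime.coprime_iff_not_dvd hp).mp hn)
        (by
          intro v
          obtain ⟨v, rfl⟩ := hπ v
          rw [hiter, hφ])
        (M.map π) (by
          rintro _ ⟨v, hv, rfl⟩
          refine ⟨φ v, ?_, rfl⟩
          have hv : v ^ p ^ (e - 1) = 1 := hv
          change φ v ^ p ^ (e - 1) = 1
          rw [← map_pow, hv, map_one])
      have hWinv : ∀ w ∈ W.comap π, φ w ∈ W.comap π := fun w hw => hW _ hw
      have hWM : W.comap π = ⊤ := by
        by_contra hT
        have hle : W ≤ M.map π := by
          intro w hw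
          obtain ⟨v, rfl⟩ := hπ w
          exact ⟨v, hsmall _ hWinv hT v hw, rfl⟩
        have hMtop : M.map π = ⊤ := by
          rw [← hcompl.sup_eq_top, sup_eq_left.mpr hle]
        obtain ⟨m, hm, hmx⟩ : π x ∈ M.map π := hMtop ▸ Subgroup.mem_top _
        have h1 : m⁻¹ * x ∈ powers V p := QuotientGroup.eq.mp hmx
        have h2 := hNM _ h1
        have hm : m ^ p ^ (e - 1) = 1 := hm
        rw [mul_pow, inv_pow, hm, inv_one, one_mul] at h2
        exact horder' x hx h2
      intro v hv
      have h1 : π v ∈ M.map π ⊓ W := ⟨⟨v, hv, rfl⟩, by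
        have : v ∈ W.comap π := hWM ▸ Subgroup.mem_top v
        exact this⟩
      rw [hcompl.inf_eq_bot, Subgroup.mem_bot] at h1
      exact (QuotientGroup.eq_one_iff v).mp h1
    refine ⟨fun v hv => mem_powers_iff.mp (hMN v hv), ?_, fun U hNU hU => ?_⟩
    · by_contra! hcon
      have hxA : x ∈ A := hAtop ▸ Subgroup.mem_top x
      obtain ⟨v, rfl⟩ := hxA
      exact horder' _ hx (hNM _ (hcon v))
    · refine or_iff_not_imp_right.mpr fun hT => le_antisymm (fun u hu => ?_) hNU
      exact hMN u (hsmall U hU hT u hu)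
  · left
    have hco := horder c hc1
    have hcpow : ∀ k : ℤ, φ (c ^ k) = c ^ k := fun k => by rw [map_zpow, hc]
    have hdisj : ∀ a ∈ Subgroup.zpowers c, a ∈ A → a = 1 := by
      rintro _ ⟨k, rfl⟩ hk
      exact hAfix _ hk (hcpow k)
    -- ⟨c⟩W has full exponent because of c, and is not fixed pointwise because φ fixes only 1 in A.
    have hsup : ∀ W ≤ A, (∀ w ∈ W, φ w ∈ W) → W ≠ ⊥ → Subgroup.zpowers c ⊔ W = ⊤ := by
      intro W hWA hW hbot
      refine (hdich (Subgroup.zpowers c ⊔ W) ?_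
        ⟨c, Subgroup.mem_sup_left (Subgroup.mem_zpowers c), hco⟩).resolve_right fun hfix => ?_
      · intro u hu
        obtain ⟨_, ⟨k, rfl⟩, w, hw, rfl⟩ := Subgroup.mem_sup.mp hu
        rw [map_mul]
        exact Subgroup.mul_mem_sup ⟨k, (hcpow k).symm⟩ (hW w hw)
      · exact hbot ((Subgroup.eq_bot_iff_forall W).mpr fun w hw =>
          hAfix w (hWA hw) (hfix w (Subgroup.mem_sup_right hw)))
    have hirr : ∀ W ≤ A, (∀ w ∈ W, φ w ∈ W) → W = ⊥ ∨ W = A := by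
      intro W hWA hW
      refine or_iff_not_imp_left.mpr fun hbot => le_antisymm hWA fun a ha => ?_
      obtain ⟨b, hb, w, hw, rfl⟩ := Subgroup.mem_sup.mp
        (hsup W hWA hW hbot ▸ Subgroup.mem_top a)
      rw [hdisj b hb ((Subgroup.mul_mem_cancel_right A (hWA hw)).mp ha), one_mul]
      exact hw
    obtain ⟨a, ha, hane⟩ := hAne
    have ha1 : a ≠ 1 := by
      rintro rfl
      exact hane (map_one φ)
    have hAbot : A ≠ ⊥ := fun h => ha1 (by rwa [h, Subgroup.mem_bot] at ha)
    -- A^p is invariant, so it is 1 or A. If it were A, iterating would make every element of A a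
    -- p^e-th power, hence trivial.
    have hAp : ∀ a ∈ A, a ^ p = 1 := by
      rcases hirr (A.map (powMonoidHom p)) (by
          rintro _ ⟨b, hb, rfl⟩
          exact A.pow_mem hb p) (by
          rintro _ ⟨b, hb, rfl⟩
          exact ⟨φ b, hAinv b hb, by simp⟩) with h | h
      · intro b hb
        have : b ^ p ∈ A.map (powMonoidHom p) := ⟨b, hb, rfl⟩
        rwa [h, Subgroup.mem_bot] at this
      · exfalso
        obtain ⟨b, hb, rfl⟩ := exists_mem_pow_pow_eq (fun a ha => by
          have : a ∈ A.map (powMonoidHom p) := by rw [h]; exact ha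
          exact this) e a ha
        exact ha1 (hexp b)
    refine ⟨c, A, ?_, hco, hc, ⟨Subgroup.disjoint_def.mpr fun {b} hb hbA => hdisj b hb hbA, ?_⟩,
      hAp, hAinv, ⟨a, ha, hane⟩, hirr⟩
    -- If e = 1, then A already contains elements of full order p, so it is all of V or fixed
    -- pointwise; the first contradicts the fixed element c, the second the choice of a.
    · by_contra hlt
      obtain rfl : e = 1 := by omega
      have hao : orderOf a = p ^ 1 := by rw [pow_one]; exact orderOf_eq_prime (hAp a ha) ha1
      rcases hdich A hAinv ⟨a, ha, hao⟩ with h | h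
      · exact hc1 (by rw [hAfix c (h ▸ Subgroup.mem_top c) hc, one_pow])
      · exact hane (h a ha)
    · rw [codisjoint_iff]
      exact hsup A le_rfl hAinv hAbot

end AbelianAction
end ExpCrit

/-! ### Normal Sylow p-subgroup: families I, II and III. -/

namespace ExpCrit

/-- Every proper subgroup containing an element of order `n` is abelian. -/
def AbelianAbove (G : Type*) [Group G] (n : ℕ) : Prop :=
  ∀ H : Subgroup G, ∀ x ∈ H, orderOf x = n → H ≠ ⊤ → ∀ a ∈ H, ∀ b ∈ H, a * b = b * a

section Complements

variable {G : Type*} [Group G]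

/-- Dedekind's law: in a = ub with u in U ≤ A, the factor b lies in A ∩ B = 1. -/
theorem eq_of_sup_eq_top_of_normal {A B U : Subgroup G} [B.Normal] (hd : Disjoint A B)
    (hU : U ≤ A) (h : U ⊔ B = ⊤) : U = A := by
  refine le_antisymm hU fun a ha => ?_
  obtain ⟨u, hu, b, hb, rfl⟩ := Subgroup.mem_sup_of_normal_right.mp (h ▸ Subgroup.mem_top a)
  have hb1 := Subgroup.disjoint_def.mp hd ((Subgroup.mul_mem_cancel_left A (hU hu)).mp ha) hb
  rwa [hb1, mul_one]

theorem exists_mul_of_le_normalizer {U B : Subgroup G}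
    (hB : B ≤ Subgroup.normalizer (U : Set G)) {g : G} (hg : g ∈ U ⊔ B) :
    ∃ u ∈ U, ∃ b ∈ B, u * b = g := by
  rw [← SetLike.mem_coe, Subgroup.coe_mul_of_right_le_normalizer_left U B hB] at hg
  exact hg

theorem eq_of_sup_eq_top_of_le_normalizer {A B U : Subgroup G} (hd : Disjoint A B)
    (hU : U ≤ A) (hB : B ≤ Subgroup.normalizer (U : Set G)) (h : U ⊔ B = ⊤) : U = A := by
  refine le_antisymm hU fun a ha => ?_
  obtain ⟨u, hu, b, hb, rfl⟩ := exists_mul_of_le_normalizer hB (h ▸ Subgroup.mem_top a)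
  have hb1 := Subgroup.disjoint_def.mp hd ((Subgroup.mul_mem_cancel_left A (hU hu)).mp ha) hb
  rwa [hb1, mul_one]

theorem normal_of_commute_of_sup_eq_top {A B : Subgroup G} (h : A ⊔ B = ⊤)
    (hc : ∀ a ∈ A, ∀ b ∈ B, a * b = b * a) : B.Normal := by
  rw [← Subgroup.normalizer_eq_top_iff, eq_top_iff, ← h]
  refine sup_le (fun a ha => ?_) Subgroup.le_normalizer
  refine Subgroup.mem_normalizer_iff.mpr fun b => ⟨fun hb => ?_, fun hb => ?_⟩
  · rwa [hc a ha b hb, mul_inv_cancel_right]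
  · have := hc a ha _ hb
    rw [inv_mul_cancel_right, mul_assoc] at this
    rwa [mul_assoc, mul_left_cancel this] at hb

theorem sylow_isComplement' [Finite G] {p q : ℕ} [Fact p.Prime] [Fact q.Prime] (hpq : p ≠ q)
    (hG : (Nat.card G).primeFactors = {p, q}) (P : Sylow p G) (Q : Sylow q G) :
    (P : Subgroup G).IsComplement' (Q : Subgroup G) := by
  refine Subgroup.isComplement'_of_coprime ?_
    (IsPGroup.coprime_card_of_ne p q hpq _ _ P.isPGroup' Q.isPGroup')
  rw [P.card_eq_multiplicity, Q.card_eq_multiplicity]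
  conv_rhs => rw [← Nat.prod_factorization_pow_eq_self (Nat.card_pos (α := G)).ne',
    Nat.prod_factorization_eq_prod_primeFactors, hG, Finset.prod_pair hpq]

end Complements

variable {G : Type*} [Group G] {p q e : ℕ}

/-- Q is non-abelian since G is. Thus ⟨x⟩Q = G, which gives P = ⟨x⟩; and for H < Q the product HP is
proper and contains x, so H is abelian. -/
theorem familyI_of_normal (P : Sylow p G) (Q : Sylow q G) (hP : (P : Subgroup G).Normal)
    (hQ : (Q : Subgroup G).Normal) (hPQ : (P : Subgroup G).IsComplement' (Q : Subgroup G))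
    (hPc : ∀ a ∈ (P : Subgroup G), ∀ b ∈ (P : Subgroup G), a * b = b * a)
    (hG : ¬ IsMulCommutative G) {x : G} (hxP : x ∈ (P : Subgroup G)) (hx : orderOf x = p ^ e)
    (hW : AbelianAbove G (p ^ e)) : FamilyI p G := by
  have hcomm := Subgroup.commute_of_normal_of_disjoint _ _ hP hQ hPQ.disjoint
  have hQc : ¬ ∀ a ∈ (Q : Subgroup G), ∀ b ∈ (Q : Subgroup G), a * b = b * a := by
    intro hQc
    refine hG (isMulCommutative_iff.mpr fun a b => ?_)
    obtain ⟨a₁, ha₁, a₂, ha₂, rfl⟩ := Subgroup.mem_sup_of_normal_right.mp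
      (hPQ.sup_eq_top ▸ Subgroup.mem_top a)
    obtain ⟨b₁, hb₁, b₂, hb₂, rfl⟩ := Subgroup.mem_sup_of_normal_right.mp
      (hPQ.sup_eq_top ▸ Subgroup.mem_top b)
    have h₁ : Commute a₁ b₁ := hPc a₁ ha₁ b₁ hb₁
    exact ((h₁.mul_right (hcomm a₁ b₂ ha₁ hb₂)).mul_left
      ((hcomm b₁ a₂ hb₁ ha₂).symm.mul_right (hQc a₂ ha₂ b₂ hb₂))).eq
  refine ⟨P, Q, hP, hQ, hPQ, ?_, ?_, fun H hH => ?_⟩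
  · refine (Subgroup.isCyclic_iff_exists_zpowers_eq_top _).mpr ⟨x, ?_⟩
    refine eq_of_sup_eq_top_of_normal hPQ.disjoint (Subgroup.zpowers_le.mpr hxP) ?_
    by_contra hT
    have h := hW _ x (Subgroup.mem_sup_left (Subgroup.mem_zpowers x)) hx hT
    exact hQc fun a ha b hb => h a (Subgroup.mem_sup_right ha) b (Subgroup.mem_sup_right hb)
  · rwa [isMulCommutative_iff_of_setLike]
  · have hT : H.map (Q : Subgroup G).subtype ⊔ P ≠ ⊤ := by
      intro hT
      have := eq_of_sup_eq_top_of_normal hPQ.disjoint.symm (Subgroup.map_subtype_le H) hT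
      refine hH (Subgroup.map_injective (Q : Subgroup G).subtype_injective ?_)
      rw [this, ← MonoidHom.range_eq_map, Subgroup.range_subtype]
    have h := hW _ x (Subgroup.mem_sup_right hxP) hx hT
    refine IsMulCommutative.of_setLike_mul_comm fun a ha b hb => Subtype.ext ?_
    exact h a (Subgroup.mem_sup_left ⟨a, ha, rfl⟩) b (Subgroup.mem_sup_left ⟨b, hb, rfl⟩)

/-- An element y with ⟨y⟩P proper centralizes P. So any y in Q not centralizing P generates Q, and
y^q must centralize P, since it cannot generate Q as well. -/
theorem exists_generator_of_normal_left [Fact q.Prime] (P : Sylow p G) (Q : Sylow q G)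
    (hP : (P : Subgroup G).Normal) (hQ : ¬ (Q : Subgroup G).Normal)
    (hPQ : (P : Subgroup G).IsComplement' (Q : Subgroup G))
    {x : G} (hxP : x ∈ (P : Subgroup G)) (hx : orderOf x = p ^ e)
    (hW : AbelianAbove G (p ^ e)) :
    ∃ y, Subgroup.zpowers y = (Q : Subgroup G) ∧
      y ∉ Subgroup.centralizer ((P : Subgroup G) : Set G) ∧
      y ^ q ∈ Subgroup.centralizer ((P : Subgroup G) : Set G) := by
  have hcent : ∀ y, Subgroup.zpowers y ⊔ P ≠ ⊤ →
      y ∈ Subgroup.centralizer ((P : Subgroup G) : Set G) := fun y hT =>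
    Subgroup.mem_centralizer_iff.mpr fun a ha =>
      hW _ x (Subgroup.mem_sup_right hxP) hx hT a (Subgroup.mem_sup_right ha) y
        (Subgroup.mem_sup_left (Subgroup.mem_zpowers y))
  obtain ⟨y, hyQ, hy⟩ : ∃ y ∈ (Q : Subgroup G),
      y ∉ Subgroup.centralizer ((P : Subgroup G) : Set G) := by
    by_contra! h
    exact hQ (normal_of_commute_of_sup_eq_top hPQ.sup_eq_top fun a ha b hb =>
      Subgroup.mem_centralizer_iff.mp (h b hb) a ha)
  have hgen : ∀ z ∈ (Q : Subgroup G), Subgroup.zpowers z ⊔ P = ⊤ →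
      Subgroup.zpowers z = (Q : Subgroup G) := fun z hz hT =>
    eq_of_sup_eq_top_of_normal hPQ.disjoint.symm (Subgroup.zpowers_le.mpr hz) hT
  have hyt : Subgroup.zpowers y ⊔ P = ⊤ := by
    by_contra hT
    exact hy (hcent y hT)
  refine ⟨y, hgen y hyQ hyt, hy, hcent _ fun hT => ?_⟩
  -- Then q is prime to the order of y, which is a power of q.
  have h1 : y ∈ Subgroup.zpowers (y ^ q) := hgen _ (Subgroup.pow_mem _ hyQ q) hT ▸ hyQ
  rw [mem_zpowers_pow_iff] at h1
  obtain ⟨k, hk⟩ := IsPGroup.iff_orderOf.mp Q.isPGroup' ⟨y, hyQ⟩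
  rw [Subgroup.orderOf_mk] at hk
  rcases Nat.eq_zero_or_pos k with rfl | hk0
  · rw [pow_zero, orderOf_eq_one_iff] at hk
    exact hy (hk ▸ Subgroup.one_mem _)
  · rw [hk] at h1
    exact (Fact.out : q.Prime).ne_one (Nat.eq_one_of_dvd_coprimes h1 dvd_rfl (dvd_pow_self q hk0.ne'))

theorem index_centralizer_eq [Fact q.Prime] {P : Subgroup G} (hP : P.Normal)
    (hPc : ∀ a ∈ P, ∀ b ∈ P, a * b = b * a) {y : G} (hy : P ⊔ Subgroup.zpowers y = ⊤)
    (hyP : y ∉ Subgroup.centralizer (P : Set G)) (hyq : y ^ q ∈ Subgroup.centralizer (P : Set G)) :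
    (Subgroup.centralizer (P : Set G)).index = q := by
  let π := QuotientGroup.mk' (Subgroup.centralizer (P : Set G))
  have htop : Subgroup.zpowers (π y) = ⊤ := by
    rw [eq_top_iff]
    intro g _
    obtain ⟨g, rfl⟩ := QuotientGroup.mk'_surjective _ g
    obtain ⟨a, ha, _, ⟨k, rfl⟩, rfl⟩ := Subgroup.mem_sup_of_normal_left.mp (hy ▸ Subgroup.mem_top g)
    have ha : π a = 1 := (QuotientGroup.eq_one_iff a).mpr
      (Subgroup.mem_centralizer_iff.mpr fun b hb => hPc b hb a ha)
    exact ⟨k, by simp [map_mul, π, ha] ⟩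
  rw [Subgroup.index, ← orderOf_eq_card_of_zpowers_eq_top htop]
  refine orderOf_eq_prime ?_ ?_
  · rw [← map_pow]
    exact (QuotientGroup.eq_one_iff _).mpr hyq
  · exact fun h => hyP ((QuotientGroup.eq_one_iff y).mp h)

open scoped IsMulCommutative in
theorem familyII_or_familyIII [Finite G] [Fact p.Prime] [Fact q.Prime] (hpq : p ≠ q) (he : 0 < e)
    (P : Sylow p G) (Q : Sylow q G)
    (hP : (P : Subgroup G).Normal) (hQ : ¬ (Q : Subgroup G).Normal)
    (hPQ : (P : Subgroup G).IsComplement' (Q : Subgroup G))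
    (hPc : ∀ a ∈ (P : Subgroup G), ∀ b ∈ (P : Subgroup G), a * b = b * a)
    (hexp : ∀ a ∈ (P : Subgroup G), a ^ p ^ e = 1)
    {x : G} (hxP : x ∈ (P : Subgroup G)) (hx : orderOf x = p ^ e)
    (hW : AbelianAbove G (p ^ e)) : FamilyII p q G ∨ FamilyIII p q G := by
  obtain ⟨y, hyQ, hyP, hyq⟩ := exists_generator_of_normal_left P Q hP hQ hPQ hxP hx hW
  have hindex := index_centralizer_eq hP hPc (hyQ ▸ hPQ.sup_eq_top) hyP hyq
  have hQcyc : IsCyclic Q := (Subgroup.isCyclic_iff_exists_zpowers_eq_top _).mpr ⟨y, hyQ⟩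
  have hy : y ∈ (Q : Subgroup G) := hyQ ▸ Subgroup.mem_zpowers y
  have hPcomm : IsMulCommutative P := IsMulCommutative.of_setLike_mul_comm hPc
  let φ : (P : Subgroup G) →* (P : Subgroup G) := (MulAut.conjNormal y).toMonoidHom
  have hφ : ∀ a, (φ a : G) = y * a * y⁻¹ := fun a => MulAut.conjNormal_apply y a
  have hφk : ∀ (k : ℕ) a, ((φ^[k] a : (P : Subgroup G)) : G) = y ^ k * a * (y ^ k)⁻¹ := by
    intro k a
    induction k with
    | zero => simp
    | succ k ih =>
      rw [Function.iterate_succ_apply', hφ, ih, pow_succ']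
      group
  have hφq : ∀ a, φ^[q] a = a := by
    intro a
    refine Subtype.ext ?_
    rw [hφk, ← Subgroup.mem_centralizer_iff.mp hyq a a.2, mul_inv_cancel_right]
  have hnorm : ∀ U : Subgroup G, (∀ u ∈ U, y * u * y⁻¹ ∈ U) →
      (Q : Subgroup G) ≤ Subgroup.normalizer (U : Set G) := by
    intro U hU
    rw [← hyQ, Subgroup.zpowers_le]
    exact Subgroup.mem_normalizer_fintype hU
  -- UQ is either G, giving U = P by Dedekind, or a proper subgroup with an element of order p^e,
  -- hence abelian, so y centralizes U.
  have hdich : ∀ U : Subgroup P, (∀ u ∈ U, φ u ∈ U) → (∃ u ∈ U, orderOf u = p ^ e) →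
      U = ⊤ ∨ ∀ u ∈ U, φ u = u := by
    rintro U hU ⟨u, hu, huo⟩
    have hUQ : (Q : Subgroup G) ≤
        Subgroup.normalizer ((U.map (P : Subgroup G).subtype : Subgroup G) : Set G) := by
      refine hnorm _ ?_
      rintro _ ⟨a, ha, rfl⟩
      exact ⟨φ a, hU a ha, hφ a⟩
    by_cases hT : U.map (P : Subgroup G).subtype ⊔ Q = ⊤
    · left
      have := eq_of_sup_eq_top_of_le_normalizer hPQ.disjoint (Subgroup.map_subtype_le U) hUQ hT
      refine Subgroup.map_injective (P : Subgroup G).subtype_injective ?_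
      rw [this, ← MonoidHom.range_eq_map, Subgroup.range_subtype]
    · right
      intro a ha
      have h := hW _ u (Subgroup.mem_sup_left (Subgroup.mem_map_of_mem _ hu))
        (by rw [Subgroup.orderOf_coe, huo]) hT y (Subgroup.mem_sup_right hy) a (Subgroup.mem_sup_left (Subgroup.mem_map_of_mem _ ha))
      refine Subtype.ext ?_
      rw [hφ]
      change y * (a : G) = a * y at h
      rw [h, mul_inv_cancel_right]
  have hne : ∃ a, φ a ≠ a := by
    by_contra! h
    refine hyP (Subgroup.mem_centralizer_iff.mpr fun a ha => ?_)
    have := congrArg Subtype.val (h ⟨a, ha⟩)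
    rw [hφ, mul_inv_eq_iff_eq_mul] at this
    exact this.symm
  rcases abelian_action_dichotomy φ he (fun a => Subtype.ext (hexp a a.2))
    ⟨⟨x, hxP⟩, by rw [Subgroup.orderOf_mk, hx]⟩ hφq
    ((Nat.coprime_primes Fact.out Fact.out).mpr hpq) hne hdich with
    ⟨c, A, he1, hco, hc, hcompl, hAp, hAinv, ⟨a, ha, hane⟩, hirr⟩ | ⟨hpow, ⟨v, hv⟩, hirr⟩
  · right
    have hyc : y * (c : G) * y⁻¹ = c := by rw [← hφ, hc]
    have hQC : (Q : Subgroup G) ≤ Subgroup.normalizer (Subgroup.zpowers (c : G) : Set G) := by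
      refine hnorm _ ?_
      rintro _ ⟨k, rfl⟩
      exact ⟨k, by simp only [← conj_zpow, hyc]⟩
    have hQA : (Q : Subgroup G) ≤
        Subgroup.normalizer ((A.map (P : Subgroup G).subtype : Subgroup G) : Set G) := by
      refine hnorm _ ?_
      rintro _ ⟨b, hb, rfl⟩
      exact ⟨φ b, hAinv b hb, hφ b⟩
    have hcz : Subgroup.zpowers (c : G) = (Subgroup.zpowers c).map (P : Subgroup G).subtype := by
      rw [MonoidHom.map_zpowers]
      rfl
    refine ⟨P, Q, e, Subgroup.zpowers (c : G), A.map (P : Subgroup G).subtype, hQC, hQA, hP, hPQ,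
      hPcomm, hQcyc, ?_, ?_, he1, inferInstance, ?_, ⟨?_, ?_⟩, ?_, ?_, ?_, hindex⟩
    · rw [hcz, ← Subgroup.map_inf _ _ _ (P : Subgroup G).subtype_injective, hcompl.inf_eq_bot,
        Subgroup.map_bot]
    · rw [hcz, ← Subgroup.map_sup, hcompl.sup_eq_top, ← MonoidHom.range_eq_map,
        Subgroup.range_subtype]
    · rw [Nat.card_zpowers, Subgroup.orderOf_coe, hco]
    · infer_instance
    · rintro ⟨_, b, hb, rfl⟩
      exact Subtype.ext (congrArg (fun v : P => (v : G)) (hAp b hb))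
    · ext b z
      obtain ⟨z, k, rfl⟩ := z
      rw [coe_conjAction_apply]
      obtain ⟨j, hj⟩ : (b : G) ∈ Subgroup.zpowers y := by rw [hyQ]; exact b.2
      have hcomm : Commute y c := mul_inv_eq_iff_eq_mul.mp hyc
      change (b : G) * (c : G) ^ k * (b : G)⁻¹ = (c : G) ^ k
      simp only at hj
      rw [← hj, (hcomm.zpow_zpow j k).eq, mul_inv_cancel_right]
    · intro h
      have h1 := congrArg Subtype.val (DFunLike.congr_fun (DFunLike.congr_fun h ⟨y, hy⟩)
        ⟨(a : G), a, ha, rfl⟩)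
      rw [coe_conjAction_apply] at h1
      exact hane (Subtype.ext ((hφ a).trans h1))
    · refine (actsIrreducibly_conjAction_iff hQA).mpr ⟨fun h => hane ?_, fun W hWA hWinv => ?_⟩
      · have h1 : (a : G) ∈ A.map (P : Subgroup G).subtype := ⟨a, ha, rfl⟩
        rw [h, Subgroup.mem_bot, OneMemClass.coe_eq_one] at h1
        rw [h1, map_one]
      · have hWP : W.subgroupOf P ≤ A := fun w hw => by
          obtain ⟨b, hb, hbw⟩ := hWA hw
          rwa [← Subtype.ext hbw]
        rw [← Subgroup.map_subgroupOf_eq_of_le (hWA.trans (Subgroup.map_subtype_le A))]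
        rcases hirr (W.subgroupOf P) hWP fun w hw => by
          rw [Subgroup.mem_subgroupOf, hφ]
          exact hWinv y hy w hw with h | h
        · left
          rw [h, Subgroup.map_bot]
        · right
          rw [h]
  · left
    obtain ⟨n, hn⟩ := exists_mulEquiv_pi_zmod Fact.out (fun a : P => Subtype.ext (hexp a a.2)) hpow
    have hQP : (Q : Subgroup G) ≤ Subgroup.normalizer ((P : Subgroup G) : Set G) :=
      Subgroup.le_normalizer_of_normal
    have hφact : ∀ a, conjAction hQP ⟨y, hy⟩ a = φ a := fun a => Subtype.ext (hφ a).symm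
    refine ⟨P, Q, e, n, hQP, hP, hPQ, hPcomm, hQcyc, he, hn, hindex, ?_, ?_⟩
    · intro h
      have h1 : QuotientGroup.mk' (powers P p) (conjAction hQP ⟨y, hy⟩ v) =
          QuotientGroup.mk' (powers P p) v :=
        DFunLike.congr_fun (DFunLike.congr_fun h ⟨y, hy⟩) (QuotientGroup.mk' (powers P p) v)
      rw [hφact, ← div_eq_one, ← map_div] at h1
      exact hv ((QuotientGroup.eq_one_iff _).mp h1)
    · rw [actsIrreducibly_quotientAction_iff]
      refine ⟨fun h => hv (h ▸ Subgroup.mem_top _), fun U hNU hU => hirr U hNU fun u hu => ?_⟩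
      rw [← hφact]
      exact hU _ u hu

end ExpCrit

/-! ### Normal Sylow q-subgroup: special groups and family IV. -/

namespace ExpCrit

theorem map_mem_of_characteristic {Q : Type*} [Group Q] (φ : MulAut Q) {H : Subgroup Q}
    (hH : H.Characteristic) {h : Q} (hh : h ∈ H) : φ h ∈ H :=
  Subgroup.characteristic_iff_map_le.mp hH φ ⟨h, hh, rfl⟩

-- With central commutators [a,b]^q = [a^q,b], which is 1 because a^q is central. Since the derived
-- subgroup is then abelian, it suffices to check generators.
open scoped IsMulCommutative commutatorElement in
theorem commutator_elementary {Q : Type*} [Group Q] {q : ℕ}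
    (hZ : commutator Q ≤ Subgroup.center Q) (hq : ∀ a : Q, a ^ q ∈ Subgroup.center Q) :
    ∀ z ∈ commutator Q, z ^ q = 1 := by
  suffices h : commutator Q ≤
      ((powMonoidHom q : Subgroup.center Q →* Subgroup.center Q).ker).map
        (Subgroup.center Q).subtype by
    intro z hz
    obtain ⟨w, hw, rfl⟩ := h hz
    exact congrArg (fun v : Subgroup.center Q => (v : Q)) hw
  rw [commutator_def, Subgroup.commutator_le]
  intro a _ b _
  have hz : ⁅a, b⁆ ∈ Subgroup.center Q :=
    hZ (Subgroup.commutator_mem_commutator (Subgroup.mem_top a) (Subgroup.mem_top b))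
  have hc : Commute ⁅a, b⁆ a := (Subgroup.mem_center_iff.mp hz a).symm
  have h1 : b * a * b⁻¹ = ⁅a, b⁆⁻¹ * a := by
    rw [commutatorElement_def]
    group
  have h2 : b * a ^ q * b⁻¹ = (⁅a, b⁆ ^ q)⁻¹ * a ^ q := by
    rw [← conj_pow, h1, hc.inv_left.mul_pow, inv_pow]
  rw [Subgroup.mem_center_iff.mp (hq a) b, mul_inv_cancel_right, right_eq_mul, inv_eq_one] at h2
  exact ⟨⟨_, hz⟩, Subtype.ext h2, rfl⟩

theorem nilpotencyClass_eq_two {Q : Type*} [Group Q] [Group.IsNilpotent Q]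
    (hZ : commutator Q ≤ Subgroup.center Q) (hQ : commutator Q ≠ ⊥) :
    Group.nilpotencyClass Q = 2 := by
  refine le_antisymm ?_ ?_
  · rw [← Subgroup.lowerCentralSeries_eq_bot_iff_nilpotencyClass_le]
    exact Subgroup.lowerCentralSeries_succ_eq_bot ⊤ hZ
  · by_contra! h
    have h1 : Group.nilpotencyClass Q ≤ 1 := by omega
    rw [Group.IsNilpotent.nilpotencyClass_le_one_iff, ← commutator_eq_bot_iff] at h1
    exact hQ h1

/-- A `q`-group with a non-trivial coprime automorphism whose proper invariant subgroups are abelian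
and fixed elementwise is special. -/
theorem isSpecial_of_forall_fixed {Q : Type*} [Group Q] [Finite Q] {q n : ℕ} [Fact q.Prime]
    (hQ : IsPGroup q Q) (φ : MulAut Q) (hφ : ∀ v, φ^[n] v = v) (hn : q.Coprime n)
    (hne : ∃ v, φ v ≠ v)
    (hfix : ∀ U : Subgroup Q, (∀ u ∈ U, φ u ∈ U) → U ≠ ⊤ →
      (∀ a ∈ U, ∀ b ∈ U, a * b = b * a) ∧ ∀ u ∈ U, φ u = u) :
    IsSpecial q Q ∧ commutator Q ≠ ⊤ ∧ (∀ z ∈ commutator Q, φ z = z) ∧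
      ∀ U : Subgroup Q, commutator Q ≤ U → (∀ u ∈ U, φ u ∈ U) → U = commutator Q ∨ U = ⊤ := by
  have hcopQ : (Nat.card Q).Coprime n := by
    obtain ⟨k, hk⟩ := hQ.exists_card_eq
    rw [hk]
    exact hn.pow_left k
  have hnil : Group.IsNilpotent Q := hQ.isNilpotent
  have hDF : commutator Q ≤ frattini Q := commutator_le_frattini Q
  have hFtop : frattini Q ≠ ⊤ := by
    intro h
    obtain ⟨v, hv⟩ := hne
    have h1 : (⊥ : Subgroup Q) = ⊤ := frattini_nongenerating (by rw [h, sup_top_eq])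
    have h2 : v = 1 := Subgroup.mem_bot.mp (h1 ▸ Subgroup.mem_top v)
    exact hv (by rw [h2, map_one])
  have hDtop : commutator Q ≠ ⊤ := fun h => hFtop (top_le_iff.mp (h ▸ hDF))
  obtain ⟨hDcomm, hDfix⟩ := hfix (commutator Q)
    (fun u hu => map_mem_of_characteristic φ inferInstance hu) hDtop
  let π : Q →* Abelianization Q := Abelianization.of
  let φ' : Abelianization Q →* Abelianization Q := Abelianization.map φ.toMonoidHom
  have hπ : Function.Surjective π := QuotientGroup.mk'_surjective _
  have hker : ∀ g, π g = 1 ↔ g ∈ commutator Q := fun g => QuotientGroup.eq_one_iff g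
  have hφ'π : ∀ v, φ' (π v) = π (φ v) := fun _ => rfl
  have hiter : ∀ (k : ℕ) (v : Q), φ'^[k] (π v) = π (φ^[k] v) := by
    intro k v
    induction k with
    | zero => rfl
    | succ k ih => rw [Function.iterate_succ_apply', ih, hφ'π, Function.iterate_succ_apply']
  -- φ acts non-trivially on Q/Q': otherwise every displacement lies in Q', is fixed, and is trivial
  -- by coprimality.
  have hne' : ∃ g, g⁻¹ * φ g ∉ commutator Q := by
    by_contra! h
    obtain ⟨v, hv⟩ := hne
    have h1 := eq_one_of_map_eq_mul φ.toMonoidHom hφ hcopQ (mul_inv_cancel_left v (φ v)).symm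
      (hDfix _ (h v))
    exact hv (inv_mul_eq_one.mp h1).symm
  have hirr' := eq_bot_or_eq_top_of_forall_fixed φ' (n := n)
    (fun v => by
      obtain ⟨v, rfl⟩ := hπ v
      rw [hiter, hφ])
    (Nat.Coprime.of_dvd_left (Subgroup.card_quotient_dvd_card _) hcopQ)
    (by
      obtain ⟨g, hg⟩ := hne'
      refine ⟨π g, fun h => hg ?_⟩
      rw [← hker, map_mul, map_inv, ← hφ'π, h, inv_mul_cancel])
    (fun W hW hT w hw => by
      obtain ⟨w, rfl⟩ := hπ w
      have hT' : W.comap π ≠ ⊤ := fun h => hT (by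
        rw [← Subgroup.map_comap_eq_self_of_surjective hπ W, h,
          Subgroup.map_top_of_surjective _ hπ])
      rw [hφ'π, (hfix (W.comap π) (fun u hu => hW _ hu) hT').2 w hw])
  have hirr : ∀ U : Subgroup Q, commutator Q ≤ U → (∀ u ∈ U, φ u ∈ U) →
      U = commutator Q ∨ U = ⊤ := by
    intro U hDU hU
    rcases hirr' (U.map π) (by rintro _ ⟨u, hu, rfl⟩; exact ⟨φ u, hU u hu, rfl⟩) with h | h
    · left
      refine le_antisymm (fun u hu => ?_) hDU
      have : π u ∈ U.map π := ⟨u, hu, rfl⟩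
      rwa [h, Subgroup.mem_bot, hker] at this
    · right
      refine eq_top_iff.mpr fun g _ => ?_
      obtain ⟨u, hu, hug⟩ : π g ∈ U.map π := h ▸ Subgroup.mem_top _
      have h1 : u⁻¹ * g ∈ commutator Q := by rw [← hker, map_mul, map_inv, hug, inv_mul_cancel]
      simpa using U.mul_mem hu (hDU h1)
  -- By irreducibility the q-th powers in Q/Q' form the trivial group or everything. The latter
  -- would make the finite q-group Q/Q' divisible by q, hence trivial.
  have hpow : ∀ a : Q, a ^ q ∈ commutator Q := by
    intro a
    rcases hirr' (powMonoidHom q : Abelianization Q →* Abelianization Q).range (by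
      rintro _ ⟨v, rfl⟩
      exact ⟨φ' v, by simp⟩) with h | h
    · have h1 : (π a) ^ q ∈ (powMonoidHom q : Abelianization Q →* Abelianization Q).range :=
        ⟨π a, rfl⟩
      rwa [h, Subgroup.mem_bot, ← map_pow, hker] at h1
    · exfalso
      refine hDtop (eq_top_iff.mpr fun g _ => ?_)
      obtain ⟨k, hk⟩ := hQ.exists_card_eq
      obtain ⟨b, -, hb⟩ := exists_mem_pow_pow_eq (A := ⊤) (p := q) (fun v _ => by
        obtain ⟨w, hw⟩ := h ▸ Subgroup.mem_top v
        exact ⟨w, Subgroup.mem_top w, hw⟩) k (π g) (Subgroup.mem_top _)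
      obtain ⟨b, rfl⟩ := hπ b
      rw [← map_pow, ← hk, pow_card_eq_one', map_one] at hb
      exact (hker g).mp hb.symm
  refine ⟨⟨hQ, ?_⟩, hDtop, hDfix, hirr⟩
  by_cases hD : commutator Q = ⊥
  · left
    refine ⟨?_, fun a => ?_⟩
    · exact (commutator_eq_bot_iff Q).mp hD
    · have := hpow a
      rwa [hD, Subgroup.mem_bot] at this
  right
  -- The centralizer of Q' is invariant and contains Q', so it is Q' or Q. As φ fixes both z and its
  -- conjugate by g, the displacement of g centralizes z; some displacement lies outside Q', so the
  -- centralizer is Q.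
  have hZD : commutator Q ≤ Subgroup.center Q := by
    have htop : Subgroup.centralizer (commutator Q : Set Q) = ⊤ := by
      refine (hirr _ (fun z hz => Subgroup.mem_centralizer_iff.mpr fun w hw => hDcomm w hw z hz)
        (fun g hg => Subgroup.mem_centralizer_iff.mpr fun z hz => ?_)).resolve_left fun h => ?_
      · rw [← hDfix z hz, ← map_mul, Subgroup.mem_centralizer_iff.mp hg z hz, map_mul]
      · obtain ⟨g, hg⟩ := hne'
        refine hg (h ▸ Subgroup.mem_centralizer_iff.mpr fun z hz => ?_)
        have h1 := hDfix _ (Subgroup.Normal.conj_mem inferInstance z hz g)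
        rw [map_mul, map_mul, map_inv, hDfix z hz] at h1
        rw [mul_inv_eq_iff_eq_mul] at h1
        calc z * (g⁻¹ * φ g) = g⁻¹ * (g * z * g⁻¹ * φ g) := by group
          _ = g⁻¹ * φ g * z := by rw [← h1, mul_assoc]
    intro z hz
    refine Subgroup.mem_center_iff.mpr fun g => ?_
    exact (Subgroup.mem_centralizer_iff.mp (htop ▸ Subgroup.mem_top g) z hz).symm
  have hDZ : Subgroup.center Q ≤ commutator Q := by
    rcases hirr (Subgroup.center Q) hZD
      (fun u hu => map_mem_of_characteristic φ inferInstance hu) with h | h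
    · exact h.le
    · exact absurd ((commutator_eq_bot_iff_center_eq_top Q).mpr h) hD
  have hF : frattini Q = commutator Q :=
    (hirr _ hDF (fun u hu => map_mem_of_characteristic φ inferInstance hu)).resolve_right hFtop
  refine ⟨nilpotencyClass_eq_two hZD hD, le_antisymm hZD hDZ,
    by rw [hF]; exact le_antisymm hDZ hZD, ?_, ?_⟩
  · exact IsMulCommutative.of_setLike_mul_comm hDcomm
  · exact fun z => Subtype.ext (commutator_elementary hZD (fun a => hZD (hpow a)) z z.2)

variable {G : Type*} [Group G] {p q e : ℕ}

/-- Elements of order p^e generate P: if g in P has smaller order, xg has order p^e. So one of them,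
y, fails to centralize Q, else P would be normal; then ⟨y⟩Q is non-abelian, hence G. -/
theorem exists_generator_of_normal_right [Fact p.Prime] (he : 0 < e) (P : Sylow p G) (Q : Sylow q G)
    (hQ : (Q : Subgroup G).Normal) (hP : ¬ (P : Subgroup G).Normal)
    (hQP : (Q : Subgroup G).IsComplement' (P : Subgroup G))
    (hPc : ∀ a ∈ (P : Subgroup G), ∀ b ∈ (P : Subgroup G), a * b = b * a)
    (hexp : ∀ a ∈ (P : Subgroup G), a ^ p ^ e = 1)
    {x : G} (hxP : x ∈ (P : Subgroup G)) (hx : orderOf x = p ^ e)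
    (hW : AbelianAbove G (p ^ e)) :
    ∃ y, orderOf y = p ^ e ∧ Subgroup.zpowers y = (P : Subgroup G) ∧
      y ∉ Subgroup.centralizer ((Q : Subgroup G) : Set G) := by
  have horder : ∀ v ∈ (P : Subgroup G), v ^ p ^ (e - 1) ≠ 1 → orderOf v = p ^ e := by
    intro v hvP hv
    have := orderOf_eq_prime_pow hv (by rw [Nat.sub_add_cancel he]; exact hexp v hvP)
    rwa [Nat.sub_add_cancel he] at this
  have hx1 : x ^ p ^ (e - 1) ≠ 1 := by
    intro h1
    have := orderOf_dvd_of_pow_eq_one h1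
    rw [hx, Nat.pow_dvd_pow_iff_le_right (Fact.out : p.Prime).one_lt] at this
    omega
  obtain ⟨y, hyP, hy, hyc⟩ : ∃ y ∈ (P : Subgroup G), orderOf y = p ^ e ∧
      y ∉ Subgroup.centralizer ((Q : Subgroup G) : Set G) := by
    by_contra! hcon
    have hcent : ∀ g ∈ (P : Subgroup G), g ∈ Subgroup.centralizer ((Q : Subgroup G) : Set G) := by
      intro g hg
      by_cases hg1 : g ^ p ^ (e - 1) = 1
      · have hcomm : Commute x g := hPc x hxP g hg
        have h1 := hcon (x * g) (Subgroup.mul_mem _ hxP hg)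
          (horder _ (Subgroup.mul_mem _ hxP hg) (by rwa [hcomm.mul_pow, hg1, mul_one]))
        exact (Subgroup.mul_mem_cancel_left _ (hcon x hxP hx)).mp h1
      · exact hcon g hg (horder g hg hg1)
    exact hP (normal_of_commute_of_sup_eq_top hQP.sup_eq_top fun a ha b hb =>
      Subgroup.mem_centralizer_iff.mp (hcent b hb) a ha)
  refine ⟨y, hy, eq_of_sup_eq_top_of_normal hQP.disjoint.symm (Subgroup.zpowers_le.mpr hyP) ?_, hyc⟩
  by_contra hT
  refine hyc (Subgroup.mem_centralizer_iff.mpr fun a ha => ?_)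
  exact hW _ y (Subgroup.mem_sup_left (Subgroup.mem_zpowers y)) hy hT a (Subgroup.mem_sup_right ha)
    y (Subgroup.mem_sup_left (Subgroup.mem_zpowers y))

theorem familyIV_of_normal [Finite G] [Fact p.Prime] [Fact q.Prime] (hpq : p ≠ q) (he : 0 < e)
    (P : Sylow p G) (Q : Sylow q G)
    (hQ : (Q : Subgroup G).Normal) (hP : ¬ (P : Subgroup G).Normal)
    (hQP : (Q : Subgroup G).IsComplement' (P : Subgroup G))
    (hPc : ∀ a ∈ (P : Subgroup G), ∀ b ∈ (P : Subgroup G), a * b = b * a)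
    (hexp : ∀ a ∈ (P : Subgroup G), a ^ p ^ e = 1)
    {x : G} (hxP : x ∈ (P : Subgroup G)) (hx : orderOf x = p ^ e)
    (hW : AbelianAbove G (p ^ e)) : FamilyIV p q G := by
  obtain ⟨y, hyo, hyP, hyc⟩ := exists_generator_of_normal_right he P Q hQ hP hQP hPc hexp hxP hx hW
  have hy : y ∈ (P : Subgroup G) := hyP ▸ Subgroup.mem_zpowers y
  let φ : MulAut (Q : Subgroup G) := MulAut.conjNormal y
  have hφ : ∀ a, (φ a : G) = y * a * y⁻¹ := fun a => MulAut.conjNormal_apply y a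
  have hφk : ∀ (k : ℕ) a, ((φ^[k] a : (Q : Subgroup G)) : G) = y ^ k * a * (y ^ k)⁻¹ := by
    intro k a
    induction k with
    | zero => simp
    | succ k ih =>
      rw [Function.iterate_succ_apply', hφ, ih, pow_succ']
      group
  have hfixed : ∀ a, φ a = a ↔ y * (a : G) = a * y := by
    intro a
    rw [Subtype.ext_iff, hφ, mul_inv_eq_iff_eq_mul]
  obtain ⟨hspec, hDtop, hDfix, hirr⟩ := isSpecial_of_forall_fixed Q.isPGroup' φ (n := p ^ e)
    (fun a => Subtype.ext (by rw [hφk, ← hyo, pow_orderOf_eq_one]; simp))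
    (((Nat.coprime_primes Fact.out Fact.out).mpr hpq.symm).pow_right e)
    (by
      by_contra! h
      exact hyc (Subgroup.mem_centralizer_iff.mpr fun a ha => ((hfixed ⟨a, ha⟩).mp (h _)).symm))
    (by
      intro U hU hT
      have hUP : (P : Subgroup G) ≤
          Subgroup.normalizer ((U.map (Q : Subgroup G).subtype : Subgroup G) : Set G) := by
        rw [← hyP, Subgroup.zpowers_le]
        refine Subgroup.mem_normalizer_fintype ?_
        rintro _ ⟨a, ha, rfl⟩
        exact ⟨φ a, hU a ha, hφ a⟩
      have hT' : U.map (Q : Subgroup G).subtype ⊔ P ≠ ⊤ := by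
        intro h
        have := eq_of_sup_eq_top_of_le_normalizer hQP.disjoint (Subgroup.map_subtype_le U) hUP h
        refine hT (Subgroup.map_injective (Q : Subgroup G).subtype_injective ?_)
        rw [this, ← MonoidHom.range_eq_map, Subgroup.range_subtype]
      have h := hW _ y (Subgroup.mem_sup_right hy) hyo hT'
      have hmem : ∀ a ∈ U, (a : G) ∈ U.map (Q : Subgroup G).subtype ⊔ P := fun a ha =>
        Subgroup.mem_sup_left (Subgroup.mem_map_of_mem _ ha)
      exact ⟨fun a ha b hb => Subtype.ext (h a (hmem a ha) b (hmem b hb)), fun a ha =>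
        (hfixed a).mpr (h y (Subgroup.mem_sup_right hy) a (hmem a ha))⟩)
  have hPQ : (P : Subgroup G) ≤ Subgroup.normalizer ((Q : Subgroup G) : Set G) :=
    Subgroup.le_normalizer_of_normal
  have hφact : ∀ a, conjAction hPQ ⟨y, hy⟩ a = φ a := fun a => Subtype.ext (hφ a).symm
  refine ⟨P, Q, hPQ, hQ, hP, hQP,
    (Subgroup.isCyclic_iff_exists_zpowers_eq_top _).mpr ⟨y, hyP⟩, hspec, ?_, fun b z hz => ?_⟩
  · rw [actsIrreducibly_quotientAction_iff]
    refine ⟨hDtop, fun U hDU hU => hirr U hDU fun u hu => ?_⟩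
    rw [← hφact]
    exact hU _ u hu
  · obtain ⟨j, hj⟩ : (b : G) ∈ Subgroup.zpowers y := by rw [hyP]; exact b.2
    have hcomm : Commute y z := (hfixed z).mp (hDfix z hz)
    refine Subtype.ext ?_
    rw [coe_conjAction_apply, ← hj]
    simp only
    rw [(hcomm.zpow_left j).eq, mul_inv_cancel_right]

end ExpCrit

/-! ### The classification assembled. -/

namespace ExpCrit

variable {G : Type*} [Group G] [Finite G] {p q : ℕ}

theorem family_of_forall_not_isWitness (hp : p.Prime) (hq : q.Prime) (hpq : p ≠ q)
    (hG : (Nat.card G).primeFactors = {p, q}) (hna : ¬ IsMulCommutative G)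
    (h : ¬ ∃ H : Subgroup G, IsWitness p H) :
    FamilyI p G ∨ FamilyII p q G ∨ FamilyIII p q G ∨ FamilyIV p q G := by
  have := Fact.mk hp
  have := Fact.mk hq
  have hpG : p ∣ Nat.card G := Nat.dvd_of_mem_primeFactors (by simp [hG])
  have hqG : q ∣ Nat.card G := Nat.dvd_of_mem_primeFactors (by simp [hG])
  have he := factorization_exponent_pos hp hpG
  have hle : ∀ {g : G} {k : ℕ}, orderOf g = p ^ k → k ≤ (Monoid.exponent G).factorization p :=
    fun hg => orderOf_le_of_factorization hp hg
  have hW : AbelianAbove G (p ^ (Monoid.exponent G).factorization p) :=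
    commute_of_forall_not_isWitness hp h
  obtain ⟨x, hx⟩ := hp.exists_orderOf_eq_pow_factorization_exponent G
  generalize (Monoid.exponent G).factorization p = e at *
  obtain ⟨P, hxP⟩ := (IsPGroup.of_card (p := p) (G := Subgroup.zpowers x) (n := e)
    (by rw [Nat.card_zpowers, hx])).exists_le_sylow
  rw [Subgroup.zpowers_le] at hxP
  have hPtop : (P : Subgroup G) ≠ ⊤ := by
    intro hT
    obtain ⟨n, hn⟩ := P.isPGroup'.exists_card_eq
    rw [hT, Subgroup.card_top] at hn
    rw [hn] at hqG
    exact hpq ((Nat.prime_dvd_prime_iff_eq hq hp).mp (hq.dvd_of_dvd_pow hqG)).symm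
  have hPc := hW P x hxP hx hPtop
  have hexp : ∀ a ∈ (P : Subgroup G), a ^ p ^ e = 1 := by
    intro a ha
    obtain ⟨k, hk⟩ := IsPGroup.iff_orderOf.mp P.isPGroup' ⟨a, ha⟩
    rw [Subgroup.orderOf_mk] at hk
    exact orderOf_dvd_iff_pow_eq_one.mp (hk ▸ pow_dvd_pow p (hle hk))
  by_cases hP : (P : Subgroup G).Normal
  · obtain ⟨Q⟩ : Nonempty (Sylow q G) := inferInstance
    have hPQ := sylow_isComplement' hpq hG P Q
    by_cases hQ : (Q : Subgroup G).Normal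
    · exact Or.inl (familyI_of_normal P Q hP hQ hPQ hPc hna hxP hx hW)
    · rcases familyII_or_familyIII hpq he P Q hP hQ hPQ hPc hexp hxP hx hW with h | h
      · exact Or.inr (Or.inl h)
      · exact Or.inr (Or.inr (Or.inl h))
  -- The normalizer is proper and contains x, so it is abelian; this is the hypothesis of Burnside's
  -- transfer theorem, whose normal complement is the required Sylow q-subgroup.
  · have hN : Subgroup.normalizer ((P : Subgroup G) : Set G) ≤
        Subgroup.centralizer ((P : Subgroup G) : Set G) := by
      have hNc := hW _ x (Subgroup.le_normalizer hxP) hx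
        (fun h => hP (Subgroup.normalizer_eq_top_iff.mp h))
      exact fun g hg => Subgroup.mem_centralizer_iff.mpr fun a ha =>
        hNc a (Subgroup.le_normalizer ha) g hg
    have hK := MonoidHom.ker_transferSylow_isComplement' P hN
    obtain ⟨Q₀⟩ : Nonempty (Sylow q G) := inferInstance
    have hcard : Nat.card (MonoidHom.transferSylow P hN).ker = Nat.card Q₀ := by
      have h1 := (sylow_isComplement' hpq hG P Q₀).card_mul_card
      have h2 := hK.card_mul_card
      rw [← h1, mul_comm] at h2
      exact Nat.eq_of_mul_eq_mul_left Nat.card_pos h2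
    let Q : Sylow q G := Sylow.ofCard _ (hcard.trans Q₀.card_eq_multiplicity)
    have hQ : (Q : Subgroup G).Normal := MonoidHom.normal_ker _
    exact Or.inr (Or.inr (Or.inr (familyIV_of_normal hpq he P Q hQ hP hK hPc hexp hxP hx hW)))

end ExpCrit

/-! ### Converse: tools and family I. -/

namespace ExpCrit

variable {G : Type*} [Group G]

/-- Iterating V = U V^p gives V = U V^(p^k) for every k; take k = m. -/
theorem eq_top_of_sup_powers_eq_top {V : Type*} [CommGroup V] {p m : ℕ} {U : Subgroup V}
    (hexp : ∀ v : V, v ^ p ^ m = 1) (h : U ⊔ powers V p = ⊤) : U = ⊤ := by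
  have hstep : ∀ (k : ℕ) (v : V), ∃ u ∈ U, ∃ w, u * w ^ p ^ k = v := by
    intro k
    induction k with
    | zero => exact fun v => ⟨1, U.one_mem, v, by simp⟩
    | succ k ih =>
      intro v
      obtain ⟨u, hu, w, rfl⟩ := ih v
      obtain ⟨u', hu', w', hw', rfl⟩ := Subgroup.mem_sup.mp (h ▸ Subgroup.mem_top w)
      obtain ⟨w, rfl⟩ := mem_powers_iff.mp hw'
      exact ⟨u * u' ^ p ^ k, U.mul_mem hu (U.pow_mem hu' _), w, by
        rw [mul_pow, ← pow_mul w, ← pow_succ', mul_assoc]⟩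
  refine eq_top_iff.mpr fun v _ => ?_
  obtain ⟨u, hu, w, rfl⟩ := hstep m v
  rwa [hexp, mul_one]

theorem not_isMulCommutative_iff {H : Subgroup G} :
    ¬ IsMulCommutative H ↔ ¬ ∀ a ∈ H, ∀ b ∈ H, a * b = b * a := by
  rw [isMulCommutative_iff_of_setLike]

variable [Finite G] {p q : ℕ}

theorem mem_sylow_of_normal [Fact p.Prime] (P : Sylow p G) (hP : (P : Subgroup G).Normal) {z : G}
    {k : ℕ} (hz : orderOf z = p ^ k) : z ∈ (P : Subgroup G) := by
  obtain ⟨P', hP'⟩ := (IsPGroup.of_card (p := p) (G := Subgroup.zpowers z) (n := k)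
    (by rw [Nat.card_zpowers, hz])).exists_le_sylow
  have := P.unique_of_normal hP
  rw [Subsingleton.elim P P']
  exact hP' (Subgroup.mem_zpowers z)

theorem zpowers_eq_sylow [Fact p.Prime] (P : Sylow p G) (hP : IsCyclic P) {z : G}
    (hzP : z ∈ (P : Subgroup G))
    (hz : orderOf z = p ^ (Monoid.exponent G).factorization p) :
    Subgroup.zpowers z = (P : Subgroup G) := by
  refine Subgroup.eq_of_le_of_card_ge (Subgroup.zpowers_le.mpr hzP) ?_
  obtain ⟨x, hx⟩ := (Subgroup.isCyclic_iff_exists_zpowers_eq_top _).mp hP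
  obtain ⟨k, hk⟩ := P.isPGroup'.exists_card_eq
  have hxo : orderOf x = p ^ k := by rw [← hk, ← hx, Nat.card_zpowers]
  rw [Nat.card_zpowers, hz, hk]
  exact Nat.pow_le_pow_right (Fact.out : p.Prime).pos (orderOf_le_of_factorization Fact.out hxo)

/-- A witness contains a generator of P, so H = P × (H ∩ K), which is G or abelian by minimality of
K. -/
theorem FamilyI.not_isWitness (hp : p.Prime) (h : FamilyI p G) (H : Subgroup G) :
    ¬ IsWitness p H := by
  have := Fact.mk hp
  intro hH
  obtain ⟨P, K, hP, hK, hPK, hcyc, hmin⟩ := h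
  obtain ⟨z, hzH, hz⟩ := hH.exists_orderOf_eq hp
  have hPz := zpowers_eq_sylow P hcyc (mem_sylow_of_normal P hP hz) hz
  have hPH : (P : Subgroup G) ≤ H := by
    rw [← hPz]
    exact Subgroup.zpowers_le.mpr hzH
  have hcomm := Subgroup.commute_of_normal_of_disjoint _ _ hP hK hPK.disjoint
  have hPc : ∀ a ∈ (P : Subgroup G), ∀ b ∈ (P : Subgroup G), a * b = b * a := by
    rw [← isMulCommutative_iff_of_setLike]
    infer_instance
  by_cases hT : H.subgroupOf K = ⊤
  · refine hH.2.1 (top_le_iff.mp ?_)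
    rw [← hPK.sup_eq_top]
    exact sup_le hPH (Subgroup.subgroupOf_eq_top.mp hT)
  · have hKc := isMulCommutative_iff_of_setLike.mp (hmin.2 _ hT)
    refine not_isMulCommutative_iff.mp hH.1 fun a ha b hb => ?_
    obtain ⟨a₁, ha₁, a₂, ha₂, rfl⟩ := Subgroup.mem_sup_of_normal_right.mp
      (hPK.sup_eq_top ▸ Subgroup.mem_top a)
    obtain ⟨b₁, hb₁, b₂, hb₂, rfl⟩ := Subgroup.mem_sup_of_normal_right.mp
      (hPK.sup_eq_top ▸ Subgroup.mem_top b)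
    have ha₂H := (Subgroup.mul_mem_cancel_left H (hPH ha₁)).mp ha
    have hb₂H := (Subgroup.mul_mem_cancel_left H (hPH hb₁)).mp hb
    have h₁ : Commute a₁ b₁ := hPc a₁ ha₁ b₁ hb₁
    have h₂ : Commute a₂ b₂ := congrArg Subtype.val
      (hKc ⟨a₂, ha₂⟩ (Subgroup.mem_subgroupOf.mpr ha₂H) ⟨b₂, hb₂⟩ (Subgroup.mem_subgroupOf.mpr hb₂H))
    exact ((h₁.mul_right (hcomm a₁ b₂ ha₁ hb₂)).mul_left
      ((hcomm b₁ a₂ hb₁ ha₂).symm.mul_right h₂)).eq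

/-- A non-abelian subgroup `H` of `P ⋊ Q`, where `Q` is a cyclic `q`-group inducing a group of order
`q` on the abelian group `P`, has an element acting on `P` as a generator of `Q`. -/
theorem exists_generator_of_not_commute [Fact q.Prime] (P Q H : Subgroup G) (hP : P.Normal)
    (hPQ : P.IsComplement' Q) (hPc : ∀ a ∈ P, ∀ b ∈ P, a * b = b * a) (hQ : IsCyclic Q)
    (hQq : IsPGroup q Q) (hindex : (Subgroup.centralizer (P : Set G)).index = q)
    (hH : ¬ ∀ a ∈ H, ∀ b ∈ H, a * b = b * a) :
    ∃ b ∈ Q, Q ≤ Subgroup.normalizer ((H ⊓ P : Subgroup G) : Set G) ∧ (P ≤ H → H = ⊤) ∧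
      ∃ u ∈ H ⊓ P, b * u * b⁻¹ ∈ H ⊓ P ∧ b * u * b⁻¹ ≠ u := by
  have hPC : P ≤ Subgroup.centralizer (P : Set G) := fun a ha =>
    Subgroup.mem_centralizer_iff.mpr fun b hb => hPc b hb a ha
  have hQc : ∀ a ∈ Q, ∀ b ∈ Q, a * b = b * a := by
    rw [← isMulCommutative_iff_of_setLike]
    infer_instance
  have hdec : ∀ g : G, ∃ a ∈ P, ∃ b ∈ Q, a * b = g := fun g =>
    Subgroup.mem_sup_of_normal_left.mp (hPQ.sup_eq_top ▸ Subgroup.mem_top g)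
  obtain ⟨h, hhH, hhC⟩ : ∃ h ∈ H, h ∉ Subgroup.centralizer (P : Set G) := by
    by_contra! hcon
    refine hH fun c hc d hd => ?_
    obtain ⟨a, ha, b, hb, rfl⟩ := hdec c
    obtain ⟨a', ha', b', hb', rfl⟩ := hdec d
    have hbC := (Subgroup.mul_mem_cancel_left _ (hPC ha)).mp (hcon _ hc)
    have hb'C := (Subgroup.mul_mem_cancel_left _ (hPC ha')).mp (hcon _ hd)
    have h₁ : Commute a a' := hPc a ha a' ha'
    have h₂ : Commute a b' := Subgroup.mem_centralizer_iff.mp hb'C a ha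
    have h₃ : Commute a' b := Subgroup.mem_centralizer_iff.mp hbC a' ha'
    have h₄ : Commute b b' := hQc b hb b' hb'
    exact ((h₁.mul_right h₂).mul_left (h₃.symm.mul_right h₄)).eq
  obtain ⟨a, ha, b, hb, rfl⟩ := hdec h
  have hbC : b ∉ Subgroup.centralizer (P : Set G) := fun hbC =>
    hhC (Subgroup.mul_mem _ (hPC ha) hbC)
  -- Write b = y^k with y a generator of Q. Since C_G(P) has index q, y^q centralizes P; as b does
  -- not, q does not divide k.
  have hbQ : Subgroup.zpowers b = Q := by
    obtain ⟨y, hy⟩ := (Subgroup.isCyclic_iff_exists_zpowers_eq_top _).mp hQ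
    have hyQ : y ∈ Q := hy ▸ Subgroup.mem_zpowers y
    obtain ⟨k, rfl⟩ : b ∈ Submonoid.powers y := by
      rw [mem_powers_iff_mem_zpowers, hy]
      exact hb
    refine le_antisymm (Subgroup.zpowers_le.mpr hb) ?_
    conv_lhs => rw [← hy]
    rw [Subgroup.zpowers_le, mem_zpowers_pow_iff]
    obtain ⟨j, hj⟩ := IsPGroup.iff_orderOf.mp hQq ⟨y, hyQ⟩
    rw [Subgroup.orderOf_mk] at hj
    rw [hj]
    refine Nat.Coprime.pow_right j (Nat.Coprime.symm ?_)
    refine ((Fact.out : q.Prime).coprime_iff_not_dvd).mpr ?_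
    rintro ⟨i, rfl⟩
    refine hbC ?_
    have hyq := (Subgroup.centralizer (P : Set G)).pow_index_mem y
    rw [hindex] at hyq
    simp only [pow_mul]
    exact Subgroup.pow_mem _ hyq i
  have hconj : ∀ u ∈ P, a * b * u * (a * b)⁻¹ = b * u * b⁻¹ := by
    intro u hu
    have h1 := hPc a ha _ (hP.conj_mem u hu b)
    calc a * b * u * (a * b)⁻¹ = a * (b * u * b⁻¹) * a⁻¹ := by group
      _ = b * u * b⁻¹ := by rw [h1, mul_inv_cancel_right]
  have hinv : ∀ u ∈ H ⊓ P, b * u * b⁻¹ ∈ H ⊓ P := by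
    intro u hu
    refine ⟨?_, hP.conj_mem u hu.2 b⟩
    have h1 := H.mul_mem (H.mul_mem hhH hu.1) (H.inv_mem hhH)
    rwa [hconj u hu.2] at h1
  refine ⟨b, hb, ?_, fun hPH => ?_, ?_⟩
  · rw [← hbQ, Subgroup.zpowers_le]
    exact Subgroup.mem_normalizer_fintype hinv
  · rw [eq_top_iff, ← hPQ.sup_eq_top, ← hbQ]
    refine sup_le hPH (Subgroup.zpowers_le.mpr ?_)
    exact (Subgroup.mul_mem_cancel_left H (hPH ha)).mp hhH
  -- Otherwise ab centralizes H ∩ P, and H = (H ∩ P)⟨ab⟩ is abelian.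
  · by_contra! hcon
    have hcomm : ∀ u ∈ H ⊓ P, Commute u (a * b) := by
      intro u hu
      have h1 := hcon u hu (hinv u hu)
      rw [← hconj u hu.2, mul_inv_eq_iff_eq_mul] at h1
      exact h1.symm
    have hdecH : ∀ g ∈ H, ∃ u ∈ H ⊓ P, ∃ k : ℤ, u * (a * b) ^ k = g := by
      intro g hg
      obtain ⟨a', ha', b', hb', rfl⟩ := hdec g
      obtain ⟨k, rfl⟩ : b' ∈ Subgroup.zpowers b := by rw [hbQ]; exact hb'
      refine ⟨a' * b ^ k * ((a * b) ^ k)⁻¹, ⟨H.mul_mem hg (H.inv_mem (H.zpow_mem hhH k)), ?_⟩, k,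
        inv_mul_cancel_right _ _⟩
      have hπ : ∀ v ∈ P, QuotientGroup.mk' P v = 1 := fun v hv => (QuotientGroup.eq_one_iff v).mpr hv
      refine (QuotientGroup.eq_one_iff _).mp (?_ : QuotientGroup.mk' P _ = 1)
      simp only [map_mul, map_inv, map_zpow, hπ a ha, hπ a' ha', one_mul, mul_inv_cancel]
    refine hH fun c hc d hd => ?_
    obtain ⟨u, hu, k, rfl⟩ := hdecH c hc
    obtain ⟨v, hv, j, rfl⟩ := hdecH d hd
    have h₁ : Commute u v := hPc u hu.2 v hv.2
    exact ((h₁.mul_right ((hcomm u hu).zpow_right j)).mul_left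
      (((hcomm v hv).zpow_right k).symm.mul_right ((Commute.refl _).zpow_zpow k j))).eq

end ExpCrit

/-! ### Converse: families II, III and IV. -/

namespace ExpCrit

variable {G : Type*} [Group G]

theorem exists_orderOf_eq_of_mulEquiv_pi {V : Type*} [Group V] {p m n : ℕ}
    (hn : n ≠ 0) (E : V ≃* (Fin n → Multiplicative (ZMod (p ^ m)))) :
    ∃ v : V, orderOf v = p ^ m := by
  have hpow : ∀ k : ℕ, (E.symm fun _ => Multiplicative.ofAdd 1) ^ k = 1 ↔ p ^ m ∣ k := by
    intro k
    rw [← map_pow, EmbeddingLike.map_eq_one_iff, ← ZMod.natCast_eq_zero_iff]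
    have : Nonempty (Fin n) := ⟨⟨0, Nat.pos_of_ne_zero hn⟩⟩
    rw [funext_iff]
    simp only [Pi.pow_apply, Pi.one_apply, forall_const, ← ofAdd_nsmul, ofAdd_eq_one, nsmul_one]
  exact ⟨_, Nat.dvd_antisymm (orderOf_dvd_of_pow_eq_one ((hpow _).mpr dvd_rfl))
    ((hpow _).mp (pow_orderOf_eq_one _))⟩

theorem pow_eq_one_of_mulEquiv_pi {V : Type*} [Group V] {k n : ℕ}
    (E : V ≃* (Fin n → Multiplicative (ZMod k))) (v : V) : v ^ k = 1 := by
  apply E.injective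
  rw [map_pow, map_one]
  funext i
  have := pow_card_eq_one' (x := E v i)
  rwa [Nat.card_congr Multiplicative.toAdd, Nat.card_zmod] at this

variable [Finite G] {p q : ℕ}

open scoped IsMulCommutative in
theorem FamilyII.not_isWitness (hp : p.Prime) (hq : q.Prime) (h : FamilyII p q G)
    (H : Subgroup G) : ¬ IsWitness p H := by
  have := Fact.mk hp
  have := Fact.mk hq
  intro hH
  obtain ⟨P, Q, m, n, hQP, hP, hPQ, hPcomm, hQ, hm, ⟨E⟩, hindex, -, hirr⟩ := h
  rw [actsIrreducibly_quotientAction_iff] at hirr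
  obtain ⟨z, hzH, hz⟩ := hH.exists_orderOf_eq hp
  have hzP := mem_sylow_of_normal P hP hz
  obtain ⟨b, hb, hQH, htop, -⟩ := exists_generator_of_not_commute (P : Subgroup G) Q H hP hPQ
    (isMulCommutative_iff_of_setLike.mp hPcomm) hQ Q.isPGroup' hindex
    (not_isMulCommutative_iff.mp hH.1)
  have hn : n ≠ 0 := by
    rintro rfl
    have : Subsingleton P := E.toEquiv.subsingleton
    exact hirr.1 (Subsingleton.elim _ _)
  obtain ⟨v, hv⟩ := exists_orderOf_eq_of_mulEquiv_pi hn E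
  have hmf := orderOf_le_of_factorization hp ((Subgroup.orderOf_coe v).trans hv)
  have hzpow : (⟨z, hzP⟩ : P) ∉ powers P p := by
    intro hmem
    obtain ⟨w, hw⟩ := mem_powers_iff.mp hmem
    have h1 : (⟨z, hzP⟩ : P) ^ p ^ (m - 1) = 1 := by
      rw [← hw, ← pow_mul, ← pow_succ', Nat.sub_add_cancel hm, pow_eq_one_of_mulEquiv_pi E]
    have h2 := orderOf_dvd_of_pow_eq_one h1
    rw [Subgroup.orderOf_mk, hz, Nat.pow_dvd_pow_iff_le_right hp.one_lt] at h2
    omega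
  -- (H ∩ P)P^p is Q-invariant, hence P^p or P. The first is excluded because z is not a p-th power;
  -- the second gives P ≤ H, so H = G.
  rcases hirr.2 (H.subgroupOf P ⊔ powers P p) le_sup_right (by
    intro b v hv
    obtain ⟨u, hu, w, hw, rfl⟩ := Subgroup.mem_sup.mp hv
    rw [map_mul]
    refine Subgroup.mul_mem_sup ?_ (map_mem_of_characteristic _ inferInstance hw)
    exact ((Subgroup.mem_normalizer_iff.mp (hQH b.2) u).mp ⟨hu, u.2⟩).1) with h | h
  · exact hzpow (h ▸ Subgroup.mem_sup_left (Subgroup.mem_subgroupOf.mpr hzH))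
  · exact hH.2.1 (htop (Subgroup.subgroupOf_eq_top.mp
      (eq_top_of_sup_powers_eq_top (pow_eq_one_of_mulEquiv_pi E) h)))

theorem FamilyIII.not_isWitness (hp : p.Prime) (hq : q.Prime) (h : FamilyIII p q G)
    (H : Subgroup G) : ¬ IsWitness p H := by
  have := Fact.mk hp
  have := Fact.mk hq
  intro hH
  obtain ⟨P, Q, m, C, A, hQC, hQA, hP, hPQ, hPcomm, hQ, -, hCA, hm, hC, hCcard, hA, hCfix, -, hirr,
    hindex⟩ := h
  rw [actsIrreducibly_conjAction_iff] at hirr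
  have hPc := isMulCommutative_iff_of_setLike.mp hPcomm
  obtain ⟨z, hzH, hz⟩ := hH.exists_orderOf_eq hp
  have hzP := mem_sylow_of_normal P hP hz
  obtain ⟨b, hb, hQH, htop, u, hu, huH, hune⟩ := exists_generator_of_not_commute (P : Subgroup G) Q
    H hP hPQ hPc hQ Q.isPGroup' hindex (not_isMulCommutative_iff.mp hH.1)
  have hCP : C ≤ P := hCA ▸ le_sup_left
  have hAP : A ≤ P := hCA ▸ le_sup_right
  have hdec : ∀ g ∈ (P : Subgroup G), ∃ c ∈ C, ∃ a ∈ A, c * a = g := by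
    intro g hg
    rw [← hCA] at hg
    refine exists_mul_of_le_normalizer (fun a ha => ?_) hg
    refine Subgroup.mem_normalizer_fintype fun c hc => ?_
    rwa [hPc a (hAP ha) c (hCP hc), mul_inv_cancel_right]
  -- Since b centralizes C, the displacement of u = ca equals that of a. It is a non-trivial element
  -- of the Q-invariant group H ∩ A, which is therefore A.
  have hAH : A ≤ H := by
    obtain ⟨c, hc, a, ha, rfl⟩ := hdec u hu.2
    have hbc : b * c * b⁻¹ = c := by
      have h1 := DFunLike.congr_fun (DFunLike.congr_fun hCfix ⟨b, hb⟩) (⟨c, hc⟩ : C)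
      exact congrArg (fun v : C => (v : G)) h1
    have hba : b * a * b⁻¹ ∈ A := (Subgroup.mem_normalizer_iff.mp (hQA hb) a).mp ha
    have hconj : b * (c * a) * b⁻¹ = c * (b * a * b⁻¹) := by
      calc b * (c * a) * b⁻¹ = (b * c * b⁻¹) * (b * a * b⁻¹) := by group
        _ = c * (b * a * b⁻¹) := by rw [hbc]
    have hdiff : (c * a)⁻¹ * (b * (c * a) * b⁻¹) = a⁻¹ * (b * a * b⁻¹) := by
      rw [hconj, mul_inv_rev, mul_assoc, inv_mul_cancel_left]
    have hmem : (c * a)⁻¹ * (b * (c * a) * b⁻¹) ∈ H ⊓ A :=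
      ⟨H.mul_mem (H.inv_mem hu.1) huH.1, hdiff ▸ A.mul_mem (A.inv_mem ha) hba⟩
    rcases hirr.2 (H ⊓ A) inf_le_right (fun d hd w hw =>
      ⟨((Subgroup.mem_normalizer_iff.mp (hQH hd) w).mp ⟨hw.1, hAP hw.2⟩).1,
        (Subgroup.mem_normalizer_iff.mp (hQA hd) w).mp hw.2⟩) with h | h
    · rw [h, Subgroup.mem_bot, inv_mul_eq_one] at hmem
      exact absurd hmem.symm hune
    · exact inf_eq_right.mp h
  have hCH : C ≤ H := by
    obtain ⟨y, hy⟩ := (Subgroup.isCyclic_iff_exists_zpowers_eq_top _).mp hC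
    have hyo : orderOf y = p ^ m := by rw [← hCcard, ← hy, Nat.card_zpowers]
    have hmf := orderOf_le_of_factorization hp hyo
    obtain ⟨c, hc, a, ha, rfl⟩ := hdec z hzP
    have hcH : c ∈ H := (Subgroup.mul_mem_cancel_right H (hAH ha)).mp hzH
    have hcomm : Commute c a := hPc c (hCP hc) a (hAP ha)
    have hap : a ^ p = 1 := congrArg Subtype.val (hA.2 ⟨a, ha⟩)
    have hcne : c ^ p ^ (m - 1) ≠ 1 := by
      intro h1
      have h2 : (c * a) ^ p ^ (m - 1) = 1 := by
        -- Here m > 1 is essential: p divides p^(m-1), so this power kills a, and the large order of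
        -- z must come from c.
        obtain ⟨j, hj⟩ : ∃ j, m - 1 = j + 1 := ⟨m - 2, by omega⟩
        rw [hcomm.mul_pow, h1, one_mul, hj, pow_succ', pow_mul, hap, one_pow]
      have h3 := orderOf_dvd_of_pow_eq_one h2
      rw [hz, Nat.pow_dvd_pow_iff_le_right hp.one_lt] at h3
      omega
    have hco : orderOf c = p ^ m := by
      have hcm : c ^ p ^ (m - 1 + 1) = 1 := by
        rw [Nat.sub_add_cancel hm.le, ← hCcard]
        exact congrArg Subtype.val (pow_card_eq_one' (x := (⟨c, hc⟩ : C)))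
      have := orderOf_eq_prime_pow hcne hcm
      rwa [Nat.sub_add_cancel hm.le] at this
    have hcC : Subgroup.zpowers c = C :=
      Subgroup.eq_of_le_of_card_ge (Subgroup.zpowers_le.mpr hc) (by
        rw [Nat.card_zpowers, hco, hCcard])
    rw [← hcC]
    exact Subgroup.zpowers_le.mpr hcH
  refine hH.2.1 (htop ?_)
  rw [← hCA]
  exact sup_le hCH hAH

/-- By irreducibility (H ∩ Q)Q' is Q' or Q. In the first case H = (H ∩ Q)P with H ∩ Q ≤ Q', which is
abelian and centralized by P. In the second H ∩ Q = Q, because Q' lies in the Frattini subgroup, and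
H = G. -/
theorem commute_of_special_action {P Q : Subgroup G}
    (hPQ : P ≤ Subgroup.normalizer (Q : Set G)) (hQP : Q ⊔ P = ⊤)
    (hPc : ∀ a ∈ P, ∀ b ∈ P, a * b = b * a) (hspec : IsSpecial q Q)
    (hirr : ActsIrreducibly (quotientAction (conjAction hPQ) (commutator Q)))
    (hfix : ∀ x : P, ∀ z ∈ commutator Q, conjAction hPQ x z = z) {H : Subgroup G} (hPH : P ≤ H)
    (hH : H ≠ ⊤) : ∀ a ∈ H, ∀ b ∈ H, a * b = b * a := by
  rw [actsIrreducibly_quotientAction_iff] at hirr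
  have hDF : commutator Q ≤ frattini Q := by
    rcases hspec.2 with h | h
    · have := h.1
      rw [commutator_eq_bot]
      exact bot_le
    · exact (h.2.1.trans h.2.2.1).le
  have hDc : ∀ a ∈ commutator Q, ∀ b ∈ commutator Q, a * b = b * a := by
    rw [← isMulCommutative_iff_of_setLike]
    rcases hspec.2 with h | h
    · have := h.1
      infer_instance
    · exact h.2.2.2.1
  rcases hirr.2 (H.subgroupOf Q ⊔ commutator Q) le_sup_right (by
    intro b v hv
    obtain ⟨u, hu, w, hw, rfl⟩ := Subgroup.mem_sup_of_normal_right.mp hv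
    rw [map_mul]
    refine Subgroup.mul_mem_sup ?_ (map_mem_of_characteristic _ inferInstance hw)
    exact H.mul_mem (H.mul_mem (hPH b.2) hu) (H.inv_mem (hPH b.2))) with h | h
  · have hHD : H.subgroupOf Q ≤ commutator Q := h ▸ le_sup_left
    have hdec : ∀ g ∈ H, ∃ z : Q, z ∈ commutator Q ∧ ∃ x ∈ P, z * x = g := by
      intro g hg
      obtain ⟨z, hz, x, hx, rfl⟩ := exists_mul_of_le_normalizer hPQ (hQP ▸ Subgroup.mem_top g)
      exact ⟨⟨z, hz⟩, hHD ((Subgroup.mul_mem_cancel_right H (hPH hx)).mp hg), x, hx, rfl⟩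
    have hcomm : ∀ z ∈ commutator Q, ∀ x ∈ P, Commute x (z : G) := fun z hz x hx =>
      mul_inv_eq_iff_eq_mul.mp (congrArg Subtype.val (hfix ⟨x, hx⟩ z hz))
    intro a ha b hb
    obtain ⟨z, hz, x, hx, rfl⟩ := hdec a ha
    obtain ⟨w, hw, y, hy, rfl⟩ := hdec b hb
    have h₁ : Commute (z : G) w := congrArg Subtype.val (hDc z hz w hw)
    have h₂ : Commute x y := hPc x hx y hy
    exact ((h₁.mul_right (hcomm z hz y hy).symm).mul_left ((hcomm w hw x hx).mul_right h₂)).eq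
  · refine absurd ?_ hH
    have h1 : H.subgroupOf Q = ⊤ :=
      frattini_nongenerating (top_le_iff.mp (h ▸ sup_le_sup_left hDF _))
    rw [eq_top_iff, ← hQP]
    exact sup_le (Subgroup.subgroupOf_eq_top.mp h1) hPH

theorem FamilyIV.not_isWitness (hp : p.Prime) (h : FamilyIV p q G)
    (H : Subgroup G) : ¬ IsWitness p H := by
  have := Fact.mk hp
  intro hH
  obtain ⟨P, Q, hPQ, hQ, -, hQP, hcyc, hspec, hirr, hfix⟩ := h
  obtain ⟨z, hzH, hz⟩ := hH.exists_orderOf_eq hp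
  obtain ⟨P', hP'⟩ := (IsPGroup.of_card (p := p) (G := Subgroup.zpowers z)
    (by rw [Nat.card_zpowers, hz])).exists_le_sylow
  -- P is not normal here, so H is first conjugated to contain the given P; being proper and being
  -- abelian are unaffected.
  obtain ⟨g, hg⟩ := MulAction.exists_smul_eq G P' P
  let H' : Subgroup G := H.map (MulAut.conj g).toMonoidHom
  have hmem : ∀ a ∈ H, MulAut.conj g a ∈ H' := fun a ha => ⟨a, ha, rfl⟩
  have hzP : MulAut.conj g z ∈ (P : Subgroup G) := by
    rw [← hg, Sylow.coe_subgroup_smul]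
    exact Subgroup.smul_mem_pointwise_smul _ _ _ (hP' (Subgroup.mem_zpowers z))
  have hPz := zpowers_eq_sylow P hcyc hzP (by
    rw [← hz]
    exact orderOf_injective (MulAut.conj g).toMonoidHom (MulAut.conj g).injective z)
  have hH' : H' ≠ ⊤ := by
    intro hT
    refine hH.2.1 (Subgroup.map_injective (f := (MulAut.conj g).toMonoidHom)
      (MulAut.conj g).injective ?_)
    rw [Subgroup.map_top_of_surjective _ (MulAut.conj g).surjective]
    exact hT
  have hPc : ∀ a ∈ (P : Subgroup G), ∀ b ∈ (P : Subgroup G), a * b = b * a := by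
    rw [← isMulCommutative_iff_of_setLike]
    infer_instance
  have hcomm := commute_of_special_action hPQ hQP.sup_eq_top hPc hspec hirr hfix (H := H')
    (hPz ▸ Subgroup.zpowers_le.mpr (hmem z hzH)) hH'
  refine not_isMulCommutative_iff.mp hH.1 fun a ha b hb => ?_
  apply (MulAut.conj g).injective
  rw [map_mul, map_mul]
  exact hcomm _ (hmem a ha) _ (hmem b hb)

end ExpCrit

theorem theoremC {G : Type*} [Group G] [Finite G] (p q : ℕ)
    (hp : p.Prime) (hq : q.Prime) (hpq : p ≠ q)
    (hG : (Nat.card G).primeFactors = {p, q}) :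
    (¬ IsMulCommutative G → ExpCrit.IsExponentCritical G →
      (¬ ∃ H : Subgroup G, ExpCrit.IsWitness p H) ∨
        (¬ ∃ H : Subgroup G, ExpCrit.IsWitness q H)) ∧
    (¬ IsMulCommutative G → ExpCrit.IsExponentCritical G →
      (¬ ∃ H : Subgroup G, ExpCrit.IsWitness p H) →
      ExpCrit.FamilyI p G ∨ ExpCrit.FamilyII p q G ∨
        ExpCrit.FamilyIII p q G ∨ ExpCrit.FamilyIV p q G) ∧
    (ExpCrit.FamilyI p G ∨ ExpCrit.FamilyII p q G ∨
        ExpCrit.FamilyIII p q G ∨ ExpCrit.FamilyIV p q G →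
      ExpCrit.IsExponentCritical G) := by
  refine ⟨fun _ hc => hc.not_exists_isWitness_or hG, fun hna _ h =>
    ExpCrit.family_of_forall_not_isWitness hp hq hpq hG hna h, fun h => ?_⟩
  refine ExpCrit.isExponentCritical_of_forall_not_isWitness hp
    (Nat.dvd_of_mem_primeFactors (by simp [hG])) ?_
  rcases h with h | h | h | h
  · exact h.not_isWitness hp
  · exact h.not_isWitness hp hq
  · exact h.not_isWitness hp hq
  · exact h.not_isWitness hp
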